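/- For each $n\ge 1$ let $\mathbf H_n$ be an $n\times n$ random matrix whose entries are independent circularly symmetric complex Gaussian variables with mean $0$ and variance $1/n$. All the $\mathbf H_n$ are defined on one probability space; no assumption is made on their joint distribution for different $n$. Let $R_{1}\ge\dots\ge R_{n}$ be the singular values of $\mathbf H_n$ (almost surely positive). The channel $\mathbf y=\sqrt n\,\mathbf H_n\mathbf x+\mathbf z$ with total transmit power $P_n>0$ and noise variance $\sigma_n^2>0$ per component splits into $n$ parallel subchannels with normalized noise powers $$\eta_i=\frac{\sigma_n^2}{nR_i^2},\qquad 1\le i\le n .$$ Waterfilling gives subchannel $i$ the power $p_i=\max\{0,\lambda-\eta_i\}$, where $\lambda$ is the unique real number with $\sum_{i=1}^n\max\{0,\lambda-\eta_i\}=P_n$. Let $k_{\mathrm{opt}}(n)=\#\{i: p_i=0\}$ be the number of subchannels that waterfilling switches off. Suppose that the signal-to-noise ratio $\mathsf{SNR}=P_n/\sigma_n^2>0$ does not depend on $n$. Then, almost surely, the limit $\lim_{n\to\infty}k_{\mathrm{opt}}(n)$ exists in $\{0,1,2,\dots\}\cup\{\infty\}$ and $$\lim_{n\to\infty}k_{\mathrm{opt}}(n)>0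 .$$ Moreover, for every fixed noise variance $\sigma^2>0$ (independent of $n$), almost surely, as $n\to\infty$, the normalized noise power of the weakest subchannel satisfies $\eta_n=\sigma^2/(nR_n^2)\to\infty$ and that of the strongest satisfies $\eta_1=\sigma^2/(nR_1^2)\to 0$. -/

import Mathlib

open MeasureTheory ProbabilityTheory Filter Topology
open scoped NNReal

/-- The circularly symmetric complex Gaussian law with mean zero and variance `v`: the real and
imaginary parts are independent real Gaussians with mean zero and variance `v / 2`. -/
noncomputable def complexGaussian (v : ℝ≥0) : Measure ℂ :=
  ((gaussianReal 0 (v / 2)).prod (gaussianReal 0 (v / 2))).map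
    (fun z : ℝ × ℝ => (⟨z.1, z.2⟩ : ℂ))

/-- An `n × n` complex Gaussian random matrix: the entries are independent, each with the complex
Gaussian law of mean zero and variance `1 / n`. -/
structure IsComplexGaussianMatrix {Ω : Type*} [MeasurableSpace Ω] {n : ℕ}
    (H : Ω → Matrix (Fin n) (Fin n) ℂ) (μ : Measure Ω) : Prop where
  hasLaw : ∀ i j, HasLaw (fun ω => H ω i j) (complexGaussian (1 / (n : ℝ≥0))) μ
  indep : iIndepFun (fun (ij : Fin n × Fin n) (ω : Ω) => H ω ij.1 ij.2) μ

/-- The normalized noise power `N / (n R²)` of a subchannel of `y = √n H x + z`, where `N` is the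
noise variance. Here `R` is the singular value of `H` with index `i`; the index starts at `0` and the
singular values decrease, so `i = 0` is the strongest and `i = n - 1` the weakest subchannel.
The formula is meaningful when `H` is invertible, which a Gaussian matrix is almost surely. -/
noncomputable def normalizedNoise {n : ℕ} (N : ℝ) (H : Matrix (Fin n) (Fin n) ℂ) (i : ℕ) : ℝ :=
  N / (n * (Matrix.toEuclideanLin H).singularValues i ^ 2)

/-- `l` is a water level for the noise powers `η` and the total power `P`. -/
def IsWaterLevel {n : ℕ} (η : Fin n → ℝ) (P l : ℝ) : Prop :=
  ∑ i, max 0 (l - η i) = P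

/-- For positive total power and at least one subchannel, the water level exists and is unique. -/
theorem existsUnique_isWaterLevel {n : ℕ} (hn : 0 < n) (η : Fin n → ℝ) {P : ℝ} (hP : 0 < P) :
    ∃! l, IsWaterLevel η P l := by
  have lt_of : ∀ a b : ℝ, IsWaterLevel η P a → IsWaterLevel η P b → ¬ a < b := by
    intro a b ha hb hab
    unfold IsWaterLevel at ha hb
    have hex : ∃ i ∈ Finset.univ, 0 < max 0 (a - η i) := by
      apply Finset.exists_lt_of_sum_lt (f := fun _ => (0 : ℝ))
      simp [ha, hP]
    obtain ⟨i, -, hi⟩ := hex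
    have hi' : 0 < a - η i := by
      rcases lt_max_iff.1 hi with h | h
      · exact absurd h (lt_irrefl _)
      · exact h
    have hlt : ∑ i, max 0 (a - η i) < ∑ i, max 0 (b - η i) := by
      apply Finset.sum_lt_sum
      · intro j _
        exact max_le_max le_rfl (by linarith)
      · refine ⟨i, Finset.mem_univ _, ?_⟩
        rw [max_eq_right hi'.le, max_eq_right (by linarith)]
        linarith
    linarith
  have hne : (Finset.univ : Finset (Fin n)).Nonempty := ⟨⟨0, hn⟩, Finset.mem_univ _⟩
  obtain ⟨i₀, -, hi₀⟩ := Finset.exists_min_image Finset.univ η hne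
  have hcont : Continuous (fun l : ℝ => ∑ i, max 0 (l - η i)) := by fun_prop
  have h0 : ∑ i, max 0 (η i₀ - η i) = 0 := by
    apply Finset.sum_eq_zero
    intro i _
    exact max_eq_left (by linarith [hi₀ i (Finset.mem_univ _)])
  have h1 : P ≤ ∑ i, max 0 (η i₀ + P - η i) := by
    have := Finset.single_le_sum (f := fun i => max 0 (η i₀ + P - η i))
      (fun i _ => le_max_left _ _) (Finset.mem_univ i₀)
    have h2 : P ≤ max 0 (η i₀ + P - η i₀) := le_max_of_le_right (by linarith)
    exact h2.trans this
  obtain ⟨l, -, hl⟩ := intermediate_value_Icc (a := η i₀) (b := η i₀ + P) (by linarith)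
    hcont.continuousOn ⟨by simpa only [h0] using hP.le, h1⟩
  exact ⟨l, hl, fun b hb => le_antisymm (not_lt.1 (lt_of l b hl hb)) (not_lt.1 (lt_of b l hb hl))⟩

open Classical in
/-- The water level, that is, the unique solution `l` of `∑ i, max 0 (l - η i) = P`
(and `0` in the case that no solution exists). -/
noncomputable def waterLevel {n : ℕ} (η : Fin n → ℝ) (P : ℝ) : ℝ :=
  if h : ∃ l, IsWaterLevel η P l then h.choose else 0

/-- The power that waterfilling gives to the subchannel `i`. -/
noncomputable def waterfilling {n : ℕ} (η : Fin n → ℝ) (P : ℝ) (i : Fin n) : ℝ :=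
  max 0 (waterLevel η P - η i)

/-- The number of subchannels with zero power under waterfilling, for the channel matrix `H`,
total power `P` and noise variance `N`. -/
noncomputable def numDeactivated {n : ℕ} (P N : ℝ) (H : Matrix (Fin n) (Fin n) ℂ) : ℕ :=
  {i : Fin n | waterfilling (fun j : Fin n => normalizedNoise N H j) P i = 0}.ncard

/-!
Write `G = √n H`, whose entries are standard complex Gaussian, and let `s₁ ≥ … ≥ sₙ` be its singular
values, so that `n Rᵢ² = sᵢ²`. The theorem follows from two almost sure facts: `s₁ → ∞`, and, for
every fixed `K`, the `K`-th smallest singular value of `G` tends to zero. Indeed the water level is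
at most `P + η₁`, hence at most `P + N` for large `n`, while the noise powers of the `K` weakest
subchannels exceed every multiple of `N`. So the number of deactivated subchannels tends to `∞`
(`le_numDeactivated`). As nothing is known about the joint law for different `n`, both facts rest on
the first Borel–Cantelli lemma and need summable tail bounds.

The largest singular value dominates every entry of the first column, and all these entries are
bounded by a constant with exponentially small probability (`gaussianSquare_column_le`).

For the small ones, `minEnergy K G` is the infimum of the squared Frobenius norm of `G W` over the
`n × K` matrices `W` that do not decrease the norm. By min-max it dominates the square of the `K`-th
smallest singular value (`sq_singularValues_le_frobSq`), and it is invariant under unitary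
multiplication from the right. Rotating the first row `r` of a Gaussian matrix of size `n + 1` into a
coordinate axis turns the matrix into a block triangular one with corner `‖r‖`, left column `g` and a
Gaussian block `G` of size `n`, all independent (`lintegral_gaussianSquare_succ`). A test matrix `W`
for `G` extends by one row, chosen by least squares, and the energy of each column `t` of `G W` drops
by `|⟨g, t⟩|² / (‖r‖² + ‖g‖²)` (`minEnergy_bordered_le`). By unitary invariance of `g` this is
distributed as `‖t‖² |g₁|² / (‖r‖² + ‖g‖²)`, with mean about `‖t‖² / (2 n)`. The eighth power of the
remaining fraction has mean at most `1 - 4 / n + C / n²` (`exists_contraction_bound`), so the eighth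
moment of the least energy is `O(n⁻²)` (`exists_lintegral_minEnergy_le`). The eighth power is used
because the resulting exponent has to exceed one by a margin that absorbs the error term.

The noise power of the weakest subchannel is a quotient by `sₙ²`; that `sₙ` is almost surely positive
follows from the same removal of the first row, applied to the indicator of `det G = 0`
(`ae_det_ne_zero`).
-/

open scoped ENNReal Matrix

/-! ### Unitary matrices and the squared Euclidean norm -/

/-- The squared Euclidean norm of a complex vector, for vectors in the plain function type. -/
noncomputable def sqNorm {ι : Type*} [Fintype ι] (x : ι → ℂ) : ℝ := ∑ i, ‖x i‖ ^ 2

lemma sqNorm_nonneg {ι : Type*} [Fintype ι] (x : ι → ℂ) : 0 ≤ sqNorm x :=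
  Finset.sum_nonneg fun _ _ => by positivity

lemma sq_norm_le_sqNorm {ι : Type*} [Fintype ι] (x : ι → ℂ) (i : ι) : ‖x i‖ ^ 2 ≤ sqNorm x :=
  Finset.single_le_sum (f := fun i => ‖x i‖ ^ 2) (fun _ _ => by positivity) (Finset.mem_univ i)

lemma sqNorm_eq_zero {ι : Type*} [Fintype ι] {x : ι → ℂ} : sqNorm x = 0 ↔ x = 0 := by
  unfold sqNorm
  rw [Finset.sum_eq_zero_iff_of_nonneg (fun _ _ => by positivity)]
  simp [funext_iff]

lemma ofReal_sqNorm {ι : Type*} [Fintype ι] (x : ι → ℂ) :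
    ((sqNorm x : ℝ) : ℂ) = star x ⬝ᵥ x := by
  simp [sqNorm, dotProduct, Complex.conj_mul']

lemma sqNorm_smul {ι : Type*} [Fintype ι] (c : ℂ) (x : ι → ℂ) :
    sqNorm (c • x) = ‖c‖ ^ 2 * sqNorm x := by
  simp [sqNorm, mul_pow, Finset.mul_sum]

lemma sqNorm_star {ι : Type*} [Fintype ι] (x : ι → ℂ) : sqNorm (star x) = sqNorm x := by
  simp [sqNorm]

lemma sqNorm_eq_norm_sq {ι : Type*} [Fintype ι] (x : ι → ℂ) :
    sqNorm x = ‖WithLp.toLp 2 x‖ ^ 2 := by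
  simp [EuclideanSpace.norm_sq_eq, sqNorm]

lemma sqNorm_cons {n : ℕ} (a : ℂ) (x : Fin n → ℂ) :
    sqNorm (Fin.cons a x : Fin (n + 1) → ℂ) = ‖a‖ ^ 2 + sqNorm x := by
  simp [sqNorm, Fin.sum_univ_succ]

@[fun_prop]
lemma continuous_sqNorm {ι : Type*} [Fintype ι] : Continuous (sqNorm : (ι → ℂ) → ℝ) := by
  unfold sqNorm; fun_prop

@[fun_prop]
lemma measurable_sqNorm {ι : Type*} [Fintype ι] : Measurable (sqNorm : (ι → ℂ) → ℝ) :=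
  continuous_sqNorm.measurable

lemma sqNorm_mulVec_unitary {ι : Type*} [Fintype ι] [DecidableEq ι]
    {U : Matrix ι ι ℂ} (hU : U ∈ Matrix.unitaryGroup ι ℂ) (w : ι → ℂ) :
    sqNorm (U *ᵥ w) = sqNorm w := by
  have h : ((sqNorm (U *ᵥ w) : ℝ) : ℂ) = sqNorm w := by
    rw [ofReal_sqNorm, ofReal_sqNorm, Matrix.star_mulVec, ← Matrix.dotProduct_mulVec,
      Matrix.mulVec_mulVec, ← Matrix.star_eq_conjTranspose, Unitary.star_mul_self_of_mem hU,
      Matrix.one_mulVec]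
  exact_mod_cast h

lemma sqNorm_vecMul_unitary {ι : Type*} [Fintype ι] [DecidableEq ι]
    {U : Matrix ι ι ℂ} (hU : U ∈ Matrix.unitaryGroup ι ℂ) (w : ι → ℂ) :
    sqNorm (w ᵥ* U) = sqNorm w := by
  have h : ((sqNorm (w ᵥ* U) : ℝ) : ℂ) = sqNorm w := by
    rw [← sqNorm_star, ← sqNorm_star w, ofReal_sqNorm, ofReal_sqNorm, star_star, star_star,
      Matrix.star_vecMul, Matrix.dotProduct_mulVec, Matrix.vecMul_vecMul,
      ← Matrix.star_eq_conjTranspose, Unitary.mul_star_self_of_mem hU, Matrix.vecMul_one]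
  exact_mod_cast h

/-- Every vector is a multiple, by its norm, of the first column of a unitary matrix. -/
lemma exists_unitary_first_column {n : ℕ} (v : Fin (n + 1) → ℂ) :
    ∃ U ∈ Matrix.unitaryGroup (Fin (n + 1)) ℂ, ∀ i, v i = √(sqNorm v) * U i 0 := by
  classical
  rcases eq_or_ne v 0 with rfl | hv
  · exact ⟨1, one_mem _, fun i => by simp [sqNorm]⟩
  set w : EuclideanSpace ℂ (Fin (n + 1)) := WithLp.toLp 2 v with hw
  have hn : ‖w‖ = √(sqNorm v) := by rw [sqNorm_eq_norm_sq, Real.sqrt_sq (norm_nonneg _)]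
  have hw0 : ‖w‖ ≠ 0 := by
    rw [norm_ne_zero_iff]
    intro h
    exact hv (by simpa [hw] using h)
  let e : Fin (n + 1) → EuclideanSpace ℂ (Fin (n + 1)) := fun _ => ((‖w‖⁻¹ : ℝ) : ℂ) • w
  have he : Orthonormal ℂ (({0} : Set (Fin (n + 1))).domRestrict e) := by
    constructor
    · intro i
      simp [e, norm_smul, hw0, Set.domRestrict]
    · intro i j hij
      exact absurd (Subsingleton.elim i j) hij
  obtain ⟨b, hb⟩ := he.exists_orthonormalBasis_extension_of_card_eq
    (by simp : Module.finrank ℂ (EuclideanSpace ℂ (Fin (n + 1))) = Fintype.card (Fin (n + 1)))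
  refine ⟨(EuclideanSpace.basisFun (Fin (n + 1)) ℂ).toBasis.toMatrix b,
    OrthonormalBasis.toMatrix_orthonormalBasis_mem_unitary _ _, fun i => ?_⟩
  have h0 : b 0 = ((‖w‖⁻¹ : ℝ) : ℂ) • w := hb 0 rfl
  have : ((EuclideanSpace.basisFun (Fin (n + 1)) ℂ).toBasis.toMatrix b) i 0 = b 0 i := by
    simp [Module.Basis.toMatrix_apply]
  rw [this, h0, ← hn]
  have hc : ((‖w‖ : ℝ) : ℂ) ≠ 0 := by exact_mod_cast hw0
  simp only [PiLp.smul_apply, smul_eq_mul, Complex.ofReal_inv]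
  rw [← mul_assoc, mul_inv_cancel₀ hc, one_mul]

/-- A unitary change of coordinates turns the linear form with coefficients `star v` into the
first coordinate, up to the norm of `v`. -/
lemma exists_unitary_dotProduct {n : ℕ} (v : Fin (n + 1) → ℂ) :
    ∃ U ∈ Matrix.unitaryGroup (Fin (n + 1)) ℂ, ∀ g : Fin (n + 1) → ℂ,
      ‖star g ⬝ᵥ v‖ ^ 2 = sqNorm v * ‖(g ᵥ* U) 0‖ ^ 2 := by
  obtain ⟨U, hU, h⟩ := exists_unitary_first_column (star v)
  refine ⟨U, hU, fun g => ?_⟩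
  have : star (star g ⬝ᵥ v) = √(sqNorm v) * (g ᵥ* U) 0 := by
    rw [Matrix.star_dotProduct, star_star]
    simp only [dotProduct, Matrix.vecMul, Finset.mul_sum]
    refine Finset.sum_congr rfl fun i _ => ?_
    rw [h, sqNorm_star]
    ring
  rw [← norm_star, this, norm_mul, mul_pow, Complex.norm_real, Real.norm_eq_abs, sq_abs,
    Real.sq_sqrt (sqNorm_nonneg v)]

/-- A unitary change of coordinates moves a row vector to a multiple of the first basis vector. -/
lemma exists_unitary_vecMul {n : ℕ} (r : Fin (n + 1) → ℂ) :
    ∃ U ∈ Matrix.unitaryGroup (Fin (n + 1)) ℂ,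
      r ᵥ* U = Fin.cons ((√(sqNorm r) : ℝ) : ℂ) (0 : Fin n → ℂ) := by
  obtain ⟨U, hU, h⟩ := exists_unitary_first_column (star r)
  refine ⟨U, hU, ?_⟩
  have hr : r = star ((√(sqNorm r) : ℂ) • fun i => U i 0) := by
    ext i
    have := congrArg star (h i)
    simpa [sqNorm_star] using this
  have h1 : ∀ j, (star (fun i => U i 0) ᵥ* U) j =
      (1 : Matrix (Fin (n + 1)) (Fin (n + 1)) ℂ) 0 j := by
    intro j
    rw [← Unitary.star_mul_self_of_mem hU]
    simp [Matrix.vecMul, Matrix.mul_apply, dotProduct, Matrix.star_apply]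
  ext j
  conv_lhs => rw [hr]
  rw [star_smul, Matrix.smul_vecMul, Pi.smul_apply, h1]
  refine Fin.cases ?_ (fun j => ?_) j
  · simp
  · simp [(Fin.succ_ne_zero _).symm]

/-! ### Complex Gaussian vectors are unitarily invariant -/

instance isProbabilityMeasure_complexGaussian (v : ℝ≥0) :
    IsProbabilityMeasure (complexGaussian v) := by
  unfold complexGaussian
  exact Measure.isProbabilityMeasure_map (by
    have : Continuous fun z : ℝ × ℝ => (⟨z.1, z.2⟩ : ℂ) :=
      Complex.equivRealProdCLM.symm.continuous
    exact this.aemeasurable)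

lemma charFunDual_complexGaussian (v : ℝ≥0) (L : StrongDual ℝ ℂ) :
    charFunDual (complexGaussian v) L =
      Complex.exp (-(v * (L 1 ^ 2 + L Complex.I ^ 2) / 4)) := by
  have h : complexGaussian v = ((gaussianReal 0 (v / 2)).prod (gaussianReal 0 (v / 2))).map
      (Complex.equivRealProdCLM.symm : ℝ × ℝ →L[ℝ] ℂ) := rfl
  have h1 : ((L.comp (Complex.equivRealProdCLM.symm : ℝ × ℝ →L[ℝ] ℂ)).comp (.inl ℝ ℝ ℝ)) 1
      = L 1 := by
    simp only [ContinuousLinearMap.comp_apply, ContinuousLinearMap.inl_apply]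
    congr 1
  have h2 : ((L.comp (Complex.equivRealProdCLM.symm : ℝ × ℝ →L[ℝ] ℂ)).comp (.inr ℝ ℝ ℝ)) 1
      = L Complex.I := by
    simp only [ContinuousLinearMap.comp_apply, ContinuousLinearMap.inr_apply]
    congr 1
  rw [h, charFunDual_map, charFunDual_prod, charFunDual_eq_charFun_map_one,
    charFunDual_eq_charFun_map_one, gaussianReal_map_continuousLinearMap,
    gaussianReal_map_continuousLinearMap, charFun_gaussianReal, charFun_gaussianReal, h1, h2,
    ← Complex.exp_add]
  have h3 : ∀ x : ℝ, ((Real.toNNReal (x ^ 2) : ℝ) : ℂ) = (x : ℂ) ^ 2 := fun x => by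
    rw [Real.coe_toNNReal _ (sq_nonneg x)]
    push_cast
    rfl
  congr 1
  simp only [map_zero, NNReal.coe_mul, Complex.ofReal_mul, h3]
  simp
  ring

/-- The law of a vector with independent and identically distributed centred complex Gaussian entries
is invariant under unitary maps. -/
lemma measurePreserving_vecMul_unitary {ι : Type*} [Fintype ι] [DecidableEq ι] (v : ℝ≥0)
    {U : Matrix ι ι ℂ} (hU : U ∈ Matrix.unitaryGroup ι ℂ) :
    MeasurePreserving (fun r : ι → ℂ => r ᵥ* U) (Measure.pi fun _ => complexGaussian v)
      (Measure.pi fun _ => complexGaussian v) := by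
  let A : (ι → ℂ) →L[ℝ] (ι → ℂ) :=
    LinearMap.toContinuousLinearMap ((Matrix.vecMulLinear U).restrictScalars ℝ)
  have hA : ∀ r, A r = r ᵥ* U := fun r => rfl
  refine ⟨A.continuous.measurable, ?_⟩
  change Measure.map A _ = _
  apply Measure.ext_of_charFunDual
  ext L
  rw [charFunDual_map, charFunDual_pi, charFunDual_pi]
  simp_rw [charFunDual_complexGaussian]
  rw [← Complex.exp_sum, ← Complex.exp_sum]
  congr 1
  let w : ι → ℂ := fun j => L (Pi.single j 1) - L (Pi.single j Complex.I) * Complex.I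
  have hL : ∀ z : ι → ℂ, L z = (∑ j, z j * w j).re := by
    intro z
    have hz : z = ∑ j, ((z j).re • (Pi.single j (1 : ℂ) : ι → ℂ)
        + (z j).im • (Pi.single j Complex.I : ι → ℂ)) := by
      ext i
      simp [Finset.sum_apply, Pi.single_apply, Finset.sum_add_distrib, Complex.re_add_im]
    conv_lhs => rw [hz]
    simp [w, map_sum]
  have h1 : ∀ z : ℂ, z.re ^ 2 + (Complex.I * z).re ^ 2 = ‖z‖ ^ 2 := by
    intro z
    rw [Complex.sq_norm, Complex.normSq_apply]
    simp
    ring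
  have h2 : ∀ i, L (A (Pi.single i 1)) ^ 2 + L (A (Pi.single i Complex.I)) ^ 2
      = ‖(U *ᵥ w) i‖ ^ 2 := by
    intro i
    rw [← h1, hL, hL, hA, hA]
    simp [Matrix.mulVec, dotProduct, Finset.mul_sum, Matrix.single_vecMul, mul_assoc]
  have h3 : ∀ i, L (Pi.single i 1) ^ 2 + L (Pi.single i Complex.I) ^ 2 = ‖w i‖ ^ 2 := by
    intro i
    rw [← h1, hL, hL]
    simp [Pi.single_apply]
  have key := sqNorm_mulVec_unitary hU w
  simp only [sqNorm, ← h2, ← h3] at key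
  have key' := congrArg (fun x : ℝ => ((-(v * x / 4) : ℝ) : ℂ)) key
  push_cast [Finset.mul_sum, Finset.sum_div] at key'
  simp only [Finset.sum_neg_distrib]
  simpa [ContinuousLinearMap.comp_apply, ContinuousLinearMap.single_apply] using key'

/-! ### Gaussian matrices and removal of the first row -/

/-- The law of a vector with `n` independent standard complex Gaussian entries. -/
noncomputable def gaussianVector (n : ℕ) : Measure (Fin n → ℂ) :=
  Measure.pi fun _ => complexGaussian 1

/-- The law of a square matrix of independent standard complex Gaussian entries, as a measure on
the families of rows. -/
noncomputable def gaussianSquare (n : ℕ) : Measure (Fin n → Fin n → ℂ) :=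
  Measure.pi fun _ => gaussianVector n

instance (n : ℕ) : IsProbabilityMeasure (gaussianVector n) := by
  unfold gaussianVector; infer_instance

instance (n : ℕ) : IsProbabilityMeasure (gaussianSquare n) := by
  unfold gaussianSquare; infer_instance

/-- The block lower triangular matrix with top row `(a, 0)`, left column `(a, g)` and lower right
block `G`. -/
def bordered {n : ℕ} (a : ℂ) (g : Fin n → ℂ) (G : Fin n → Fin n → ℂ) :
    Fin (n + 1) → Fin (n + 1) → ℂ :=
  Fin.cons (Fin.cons a 0 : Fin (n + 1) → ℂ) fun i => (Fin.cons (g i) (G i) : Fin (n + 1) → ℂ)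

lemma measurePreserving_vecCons (n : ℕ) :
    MeasurePreserving (fun p : ℂ × (Fin n → ℂ) => (Fin.cons p.1 p.2 : Fin (n + 1) → ℂ))
      ((complexGaussian 1).prod (gaussianVector n)) (gaussianVector (n + 1)) := by
  have h := (measurePreserving_piFinSuccAbove
    (fun _ : Fin (n + 1) => complexGaussian 1) 0).symm
  have he : (fun p : ℂ × (Fin n → ℂ) => (Fin.cons p.1 p.2 : Fin (n + 1) → ℂ)) =
      ⇑(MeasurableEquiv.piFinSuccAbove (fun _ : Fin (n + 1) => ℂ) 0).symm := by
    ext p : 1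
    simp [MeasurableEquiv.piFinSuccAbove_symm_apply]
    rfl
  rw [he]
  exact h

lemma measurePreserving_rowCons (m n : ℕ) :
    MeasurePreserving
      (fun p : (Fin n → ℂ) × (Fin m → Fin n → ℂ) => (Fin.cons p.1 p.2 : Fin (m + 1) → Fin n → ℂ))
      ((gaussianVector n).prod (Measure.pi fun _ => gaussianVector n))
      (Measure.pi fun _ => gaussianVector n) := by
  have h := (measurePreserving_piFinSuccAbove
    (fun _ : Fin (m + 1) => gaussianVector n) 0).symm
  have he : (fun p : (Fin n → ℂ) × (Fin m → Fin n → ℂ) =>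
      (Fin.cons p.1 p.2 : Fin (m + 1) → Fin n → ℂ)) =
      ⇑(MeasurableEquiv.piFinSuccAbove (fun _ : Fin (m + 1) => Fin n → ℂ) 0).symm := by
    ext p : 1
    simp [MeasurableEquiv.piFinSuccAbove_symm_apply]
    rfl
  rw [he]
  exact h

lemma measurePreserving_colCons (m n : ℕ) :
    MeasurePreserving
      (fun p : (Fin m → ℂ) × (Fin m → Fin n → ℂ) =>
        (fun i => Fin.cons (p.1 i) (p.2 i) : Fin m → Fin (n + 1) → ℂ))
      ((gaussianVector m).prod (Measure.pi fun _ => gaussianVector n))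
      (Measure.pi fun _ => gaussianVector (n + 1)) := by
  have h1 := (measurePreserving_arrowProdEquivProdArrow ℂ (Fin n → ℂ) (Fin m)
    (fun _ => complexGaussian 1) (fun _ => gaussianVector n)).symm
  have h2 := measurePreserving_pi
    (fun _ : Fin m => (complexGaussian 1).prod (gaussianVector n))
    (fun _ => gaussianVector (n + 1)) (fun _ => measurePreserving_vecCons n)
  exact h2.comp h1

/-- Removal of the first row: rotating that row into the first coordinate axis leaves the other
rows Gaussian and independent of it. Hence the matrix may be replaced, in the expectation of a
right unitarily invariant function, by a block triangular one whose lower right block is again a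
Gaussian matrix. -/
lemma lintegral_gaussianSquare_succ {n : ℕ} {f : (Fin (n + 1) → Fin (n + 1) → ℂ) → ℝ≥0∞}
    (hf : Measurable f)
    (hinv : ∀ U ∈ Matrix.unitaryGroup (Fin (n + 1)) ℂ, ∀ G, f (fun i => G i ᵥ* U) = f G) :
    ∫⁻ G, f G ∂gaussianSquare (n + 1) =
      ∫⁻ r, ∫⁻ G, ∫⁻ g, f (bordered ((√(sqNorm r) : ℝ) : ℂ) g G) ∂gaussianVector n
        ∂gaussianSquare n ∂gaussianVector (n + 1) := by
  have hrow := measurePreserving_rowCons n (n + 1)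
  have h1 : ∫⁻ G, f G ∂gaussianSquare (n + 1) = ∫⁻ r, ∫⁻ X, f (Fin.cons r X)
      ∂(Measure.pi fun _ : Fin n => gaussianVector (n + 1)) ∂gaussianVector (n + 1) := by
    rw [gaussianSquare, ← hrow.lintegral_comp hf, lintegral_prod]
    exact (hf.comp hrow.measurable).aemeasurable
  rw [h1]
  refine lintegral_congr fun r => ?_
  obtain ⟨U, hU, hr⟩ := exists_unitary_vecMul r
  have hUp := measurePreserving_pi (fun _ : Fin n => gaussianVector (n + 1))
    (fun _ => gaussianVector (n + 1)) (fun _ => measurePreserving_vecMul_unitary 1 hU)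
  have hmeas : ∀ r : Fin (n + 1) → ℂ,
      Measurable fun X : Fin n → Fin (n + 1) → ℂ => f (Fin.cons r X) := fun r =>
    (hf.comp hrow.measurable).comp measurable_prodMk_left
  have h2 : ∫⁻ X, f (Fin.cons r X) ∂(Measure.pi fun _ : Fin n => gaussianVector (n + 1)) =
      ∫⁻ X, f (Fin.cons (Fin.cons ((√(sqNorm r) : ℝ) : ℂ) (0 : Fin n → ℂ) : Fin (n + 1) → ℂ) X)
        ∂(Measure.pi fun _ : Fin n => gaussianVector (n + 1)) := by
    rw [← hUp.lintegral_comp (hmeas (Fin.cons ((√(sqNorm r) : ℝ) : ℂ) (0 : Fin n → ℂ)))]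
    refine lintegral_congr fun X => ?_
    rw [← hinv U hU (Fin.cons r X), ← hr]
    congr 1
    ext i : 1
    refine Fin.cases ?_ (fun i => ?_) i <;> simp
  have hcol := measurePreserving_colCons n n
  rw [h2, ← hcol.lintegral_comp (hmeas _), lintegral_prod_symm]
  · rfl
  · exact ((hmeas _).comp hcol.measurable).aemeasurable

/-! ### Moments and the contraction factor -/

instance isGaussian_complexGaussian (v : ℝ≥0) : IsGaussian (complexGaussian v) := by
  change IsGaussian (Measure.map (Complex.equivRealProdCLM.symm : (ℝ × ℝ) ≃L[ℝ] ℂ) _)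
  infer_instance

instance isGaussian_pi {ι E : Type*} [Fintype ι] [NormedAddCommGroup E] [NormedSpace ℝ E]
    [MeasurableSpace E] [BorelSpace E] [SecondCountableTopology E] [CompleteSpace E]
    (ν : Measure E) [IsGaussian ν] : IsGaussian (Measure.pi fun _ : ι => ν) := by
  have h := iIndepFun.hasGaussianLaw (P := Measure.pi fun _ : ι => ν)
    (X := fun (i : ι) (ω : ι → E) => ω i)
    (fun i => (measurePreserving_eval (fun _ : ι => ν) i).hasLaw.hasGaussianLaw)
    (iIndepFun_pi (μ := fun _ : ι => ν) (X := fun _ x => x) (fun i => aemeasurable_id))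
  have := h.isGaussian_map
  simpa using this

instance (n : ℕ) : IsGaussian (gaussianVector n) := by
  unfold gaussianVector; infer_instance

instance (n : ℕ) : IsGaussian (gaussianSquare n) := by
  unfold gaussianSquare; infer_instance

lemma ProbabilityTheory.IsGaussian.integrable_norm_pow {E : Type*} [NormedAddCommGroup E]
    [NormedSpace ℝ E] [MeasurableSpace E] [BorelSpace E] [SecondCountableTopology E]
    [CompleteSpace E] (ν : Measure E) [IsGaussian ν] (k : ℕ) :
    Integrable (fun x => ‖x‖ ^ k) ν :=
  (IsGaussian.memLp_id ν k (by simp)).integrable_norm_pow'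

lemma integral_sq_norm_complexGaussian : ∫ z, ‖z‖ ^ 2 ∂complexGaussian 1 = 1 := by
  have hm : Measurable fun z : ℝ × ℝ => (⟨z.1, z.2⟩ : ℂ) :=
    Complex.equivRealProdCLM.symm.continuous.measurable
  have h2 : ∫ x, x ^ 2 ∂gaussianReal 0 (1 / 2) = 1 / 2 := by
    have := variance_id_gaussianReal (μ := 0) (v := 1 / 2)
    rw [variance_of_integral_eq_zero aemeasurable_id (by simp)] at this
    simpa using this
  have hi : Integrable (fun x : ℝ => x ^ 2) (gaussianReal 0 (1 / 2)) := by
    simpa using IsGaussian.integrable_norm_pow (gaussianReal 0 (1 / 2)) 2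
  rw [complexGaussian, integral_map hm.aemeasurable (by fun_prop)]
  have : ∀ z : ℝ × ℝ, ‖(⟨z.1, z.2⟩ : ℂ)‖ ^ 2 = z.1 ^ 2 + z.2 ^ 2 := fun z => by
    rw [Complex.sq_norm, Complex.normSq_mk]; ring
  simp_rw [this]
  rw [integral_add (hi.comp_fst _) (hi.comp_snd _), integral_fun_fst (fun x : ℝ => x ^ 2),
    integral_fun_snd (fun x : ℝ => x ^ 2), h2]
  simp
  norm_num

lemma integrable_sqNorm_gaussianVector (n : ℕ) : Integrable sqNorm (gaussianVector n) := by
  unfold sqNorm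
  refine integrable_finsetSum _ fun i _ => ?_
  exact (measurePreserving_eval (fun _ : Fin n => complexGaussian 1) i).integrable_comp_of_integrable
    (IsGaussian.integrable_norm_pow (complexGaussian 1) 2)

lemma integral_sqNorm_gaussianVector (n : ℕ) : ∫ x, sqNorm x ∂gaussianVector n = n := by
  unfold sqNorm
  have h : ∀ i : Fin n, MeasurePreserving (Function.eval i) (gaussianVector n) (complexGaussian 1) :=
    fun i => measurePreserving_eval (fun _ : Fin n => complexGaussian 1) i
  rw [integral_finsetSum]
  · have : ∀ i : Fin n, ∫ x, ‖x i‖ ^ 2 ∂gaussianVector n = 1 := fun i => by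
      rw [← integral_sq_norm_complexGaussian, ← (h i).map_eq,
        integral_map (h i).measurable.aemeasurable (by fun_prop)]
    simp [this]
  · exact fun i _ => (h i).integrable_comp_of_integrable
      (IsGaussian.integrable_norm_pow (complexGaussian 1) 2)

lemma lintegral_affine_sqNorm (n : ℕ) {a b : ℝ} (ha : 0 ≤ a) (hb : 0 ≤ b) :
    ∫⁻ x, ENNReal.ofReal (a + b * sqNorm x) ∂gaussianVector n = ENNReal.ofReal (a + b * n) := by
  have hi : Integrable (fun x => b * sqNorm x) (gaussianVector n) :=
    (integrable_sqNorm_gaussianVector n).const_mul b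
  have hi' : Integrable (fun x => a + b * sqNorm x) (gaussianVector n) :=
    (integrable_const a).add hi
  rw [← ofReal_integral_eq_lintegral_ofReal hi']
  · rw [integral_add (integrable_const a) hi, integral_const_mul, integral_sqNorm_gaussianVector]
    simp
  · exact Eventually.of_forall fun x => add_nonneg ha (mul_nonneg hb (sqNorm_nonneg x))

/-- Bernoulli's inequality, followed by the tangent line at `s = M` of the concave function
`s ↦ s / (s + 8 x)`. The bound is affine in `s`. -/
lemma one_sub_div_pow_le {x s M : ℝ} (hx : 0 ≤ x) (hs : 0 ≤ s) (hM : 0 < M) :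
    (1 - x / (s + x)) ^ 8 ≤ M ^ 2 / (M + 8 * x) ^ 2 + 8 * x / (M + 8 * x) ^ 2 * s := by
  have hMx : 0 < M + 8 * x := by positivity
  have hrhs : M ^ 2 / (M + 8 * x) ^ 2 + 8 * x / (M + 8 * x) ^ 2 * s
      = (M ^ 2 + 8 * x * s) / (M + 8 * x) ^ 2 := by ring
  rw [hrhs]
  rcases hs.eq_or_lt with rfl | hs
  · rcases hx.eq_or_lt with rfl | hx
    · simp [hM.ne']
    · rw [zero_add, div_self hx.ne', sub_self, zero_pow (by norm_num)]
      positivity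
  have h1 : 1 - x / (s + x) = (1 + x / s)⁻¹ := by
    field_simp
    ring
  have h2 : 1 + 8 * (x / s) ≤ (1 + x / s) ^ 8 := by
    have := one_add_mul_le_pow (a := x / s) (by linarith [div_nonneg hx hs.le]) 8
    exact_mod_cast this
  have hxs : 0 ≤ x / s := by positivity
  rw [h1, inv_pow]
  calc ((1 + x / s) ^ 8)⁻¹ ≤ (1 + 8 * (x / s))⁻¹ := inv_anti₀ (by positivity) h2
    _ = s / (s + 8 * x) := by field_simp
    _ ≤ _ := by
      rw [div_le_div_iff₀ (by positivity) (by positivity)]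
      nlinarith [mul_nonneg hx (sq_nonneg (s - M))]

lemma div_add_le_quadratic {c M : ℝ} (hc : 0 ≤ c) (hM : 0 < M) :
    M / (M + c) ≤ 1 - c / M + c ^ 2 / M ^ 2 := by
  rw [div_le_iff₀ (by positivity)]
  have : (1 - c / M + c ^ 2 / M ^ 2) * (M + c) = M + c ^ 3 / M ^ 2 := by
    field_simp
    ring
  rw [this]
  have : 0 ≤ c ^ 3 / M ^ 2 := by positivity
  linarith

/-- The expected eighth power of the factor by which the squared norm of a vector shrinks when the
size of the Gaussian matrix increases by one. -/
lemma exists_contraction_bound : ∃ C : ℝ, 0 ≤ C ∧ ∀ m : ℕ,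
    ∫⁻ r, ∫⁻ g, ENNReal.ofReal ((1 - ‖g 0‖ ^ 2 / (sqNorm r + sqNorm g)) ^ 8)
      ∂gaussianVector (m + 1) ∂gaussianVector (m + 2) ≤
        ENNReal.ofReal (1 - 4 / (m + 1) + C / (m + 1) ^ 2) := by
  set C := ∫ z, ‖z‖ ^ 4 ∂complexGaussian 1 with hC
  refine ⟨16 * C, by positivity, fun m => ?_⟩
  set M : ℝ := 2 * (m + 1) with hM
  have hM0 : 0 < M := by positivity
  have hcons := measurePreserving_vecCons m
  have hsplit : ∀ r : Fin (m + 2) → ℂ, ∫⁻ g,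
      ENNReal.ofReal ((1 - ‖g 0‖ ^ 2 / (sqNorm r + sqNorm g)) ^ 8)
      ∂gaussianVector (m + 1) ≤ ∫⁻ z, ∫⁻ g, ENNReal.ofReal (M ^ 2 / (M + 8 * ‖z‖ ^ 2) ^ 2
        + 8 * ‖z‖ ^ 2 / (M + 8 * ‖z‖ ^ 2) ^ 2 * (sqNorm r + sqNorm g))
        ∂gaussianVector m ∂complexGaussian 1 := by
    intro r
    rw [← hcons.lintegral_comp (by fun_prop), lintegral_prod _ (by fun_prop)]
    refine lintegral_mono fun z => lintegral_mono fun g => ENNReal.ofReal_le_ofReal ?_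
    have := one_sub_div_pow_le (x := ‖z‖ ^ 2) (s := sqNorm r + sqNorm g) (by positivity)
      (add_nonneg (sqNorm_nonneg r) (sqNorm_nonneg g)) hM0
    simpa [sqNorm_cons, add_assoc, add_comm, add_left_comm] using this
  have haverage : ∀ z : ℂ, ∫⁻ r, ∫⁻ g, ENNReal.ofReal (M ^ 2 / (M + 8 * ‖z‖ ^ 2) ^ 2
        + 8 * ‖z‖ ^ 2 / (M + 8 * ‖z‖ ^ 2) ^ 2 * (sqNorm r + sqNorm g))
        ∂gaussianVector m ∂gaussianVector (m + 2) = ENNReal.ofReal (M / (M + 8 * ‖z‖ ^ 2)) := by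
    intro z
    set A := M ^ 2 / (M + 8 * ‖z‖ ^ 2) ^ 2 with hA
    set B := 8 * ‖z‖ ^ 2 / (M + 8 * ‖z‖ ^ 2) ^ 2 with hB
    have hA0 : 0 ≤ A := by positivity
    have hB0 : 0 ≤ B := by positivity
    have : ∀ r : Fin (m + 2) → ℂ, ∫⁻ g, ENNReal.ofReal (A + B * (sqNorm r + sqNorm g))
        ∂gaussianVector m = ENNReal.ofReal ((A + B * m) + B * sqNorm r) := fun r => by
      simp_rw [mul_add, ← add_assoc]
      rw [lintegral_affine_sqNorm m (add_nonneg hA0 (mul_nonneg hB0 (sqNorm_nonneg r))) hB0]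
      congr 1
      ring
    simp_rw [this]
    rw [lintegral_affine_sqNorm _ (by positivity) hB0]
    congr 1
    have hne : M + 8 * ‖z‖ ^ 2 ≠ 0 := by positivity
    have : ((m + 2 : ℕ) : ℝ) = M - m := by rw [hM]; push_cast; ring
    rw [this, hA, hB]
    field_simp
    ring
  have hi2 := IsGaussian.integrable_norm_pow (complexGaussian 1) 2
  have hi4 := IsGaussian.integrable_norm_pow (complexGaussian 1) 4
  calc _ ≤ ∫⁻ r, ∫⁻ z, ∫⁻ g, ENNReal.ofReal (M ^ 2 / (M + 8 * ‖z‖ ^ 2) ^ 2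
        + 8 * ‖z‖ ^ 2 / (M + 8 * ‖z‖ ^ 2) ^ 2 * (sqNorm r + sqNorm g))
        ∂gaussianVector m ∂complexGaussian 1 ∂gaussianVector (m + 2) := lintegral_mono hsplit
    _ = ∫⁻ z, ENNReal.ofReal (M / (M + 8 * ‖z‖ ^ 2)) ∂complexGaussian 1 := by
      rw [lintegral_lintegral_swap]
      · exact lintegral_congr haverage
      · refine Measurable.aemeasurable (Measurable.lintegral_prod_right' (f := fun p :
          ((Fin (m + 2) → ℂ) × ℂ) × (Fin m → ℂ) => ENNReal.ofReal (M ^ 2 / (M + 8 * ‖p.1.2‖ ^ 2) ^ 2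
          + 8 * ‖p.1.2‖ ^ 2 / (M + 8 * ‖p.1.2‖ ^ 2) ^ 2 * (sqNorm p.1.1 + sqNorm p.2))) ?_)
        fun_prop
    _ ≤ ∫⁻ z, ENNReal.ofReal (1 - 8 / M * ‖z‖ ^ 2 + 64 / M ^ 2 * ‖z‖ ^ 4) ∂complexGaussian 1 := by
      refine lintegral_mono fun z => ENNReal.ofReal_le_ofReal ?_
      refine (div_add_le_quadratic (c := 8 * ‖z‖ ^ 2) (by positivity) hM0).trans (le_of_eq ?_)
      ring
    _ = ENNReal.ofReal (1 - 8 / M + 64 / M ^ 2 * C) := by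
      rw [← ofReal_integral_eq_lintegral_ofReal]
      · congr 1
        rw [integral_add, integral_sub, integral_const_mul, integral_const_mul,
          integral_sq_norm_complexGaussian]
        · simp [hC]
        · exact integrable_const _
        · exact hi2.const_mul _
        · exact (integrable_const _).sub (hi2.const_mul _)
        · exact hi4.const_mul _
      · exact ((integrable_const _).sub (hi2.const_mul _)).add (hi4.const_mul _)
      · refine Eventually.of_forall fun z => ?_
        have h := div_add_le_quadratic (c := 8 * ‖z‖ ^ 2) (by positivity) hM0
        have h0 : 0 ≤ M / (M + 8 * ‖z‖ ^ 2) := by positivity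
        have e : 1 - 8 / M * ‖z‖ ^ 2 + 64 / M ^ 2 * ‖z‖ ^ 4
          = 1 - 8 * ‖z‖ ^ 2 / M + (8 * ‖z‖ ^ 2) ^ 2 / M ^ 2 := by ring
        simp only [Pi.zero_apply]
        linarith
    _ = _ := by
      congr 1
      rw [hM]
      field_simp
      ring

/-! ### The least energy of a matrix on subspaces of fixed dimension -/

/-- The squared Frobenius norm of a matrix, summed column by column. -/
noncomputable def frobSq {n K : ℕ} (A : Matrix (Fin n) (Fin K) ℂ) : ℝ := ∑ j, sqNorm (A.col j)

/-- The matrices with `K` columns that do not decrease the Euclidean norm. They parametrize the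
`K`-dimensional subspaces, and requiring an inequality rather than an isometry leaves room for
appending a row. -/
def Expanding (n K : ℕ) : Set (Matrix (Fin n) (Fin K) ℂ) :=
  {W | ∀ x, sqNorm x ≤ sqNorm (W *ᵥ x)}

/-- The infimum of the squared Frobenius norm of `G * W` over the matrices `W` with `K` columns that
do not decrease the norm. It dominates the square of the `K`-th smallest singular value of `G`. It
takes values in `ℝ≥0∞`, where the infimum over the empty family, in the case `n < K`, is `∞`. -/
noncomputable def minEnergy {n : ℕ} (K : ℕ) (G : Fin n → Fin n → ℂ) : ℝ≥0∞ :=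
  ⨅ W : Expanding n K, ENNReal.ofReal (frobSq (Matrix.of G * W.1))

lemma frobSq_nonneg {n K : ℕ} (A : Matrix (Fin n) (Fin K) ℂ) : 0 ≤ frobSq A :=
  Finset.sum_nonneg fun _ _ => sqNorm_nonneg _

lemma minEnergy_le {n K : ℕ} (G : Fin n → Fin n → ℂ) {W : Matrix (Fin n) (Fin K) ℂ}
    (hW : W ∈ Expanding n K) : minEnergy K G ≤ ENNReal.ofReal (frobSq (Matrix.of G * W)) :=
  iInf_le (fun W : Expanding n K => ENNReal.ofReal (frobSq (Matrix.of G * W.1))) ⟨W, hW⟩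

/-- An infimum of continuous functions is upper semicontinuous, hence measurable. -/
@[fun_prop]
lemma measurable_minEnergy {n : ℕ} (K : ℕ) :
    Measurable (minEnergy K : (Fin n → Fin n → ℂ) → ℝ≥0∞) := by
  apply UpperSemicontinuous.measurable
  unfold minEnergy
  refine upperSemicontinuous_iInf fun W => Continuous.upperSemicontinuous ?_
  refine ENNReal.continuous_ofReal.comp ?_
  unfold frobSq
  refine continuous_finsetSum _ fun j _ => continuous_sqNorm.comp ?_
  refine continuous_pi fun i => ?_
  simp only [Matrix.col_apply, Matrix.mul_apply, Matrix.of_apply]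
  fun_prop

lemma minEnergy_mul_unitary {n K : ℕ} {U : Matrix (Fin n) (Fin n) ℂ}
    (hU : U ∈ Matrix.unitaryGroup (Fin n) ℂ) (G : Fin n → Fin n → ℂ) :
    minEnergy K (fun i => G i ᵥ* U) = minEnergy K G := by
  have key : ∀ V ∈ Matrix.unitaryGroup (Fin n) ℂ, ∀ G : Fin n → Fin n → ℂ,
      minEnergy K G ≤ minEnergy K (fun i => G i ᵥ* V) := by
    intro V hV G
    refine le_iInf fun W => ?_
    have hVW : V * W.1 ∈ Expanding n K := fun x => by
      rw [← Matrix.mulVec_mulVec, sqNorm_mulVec_unitary hV]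
      exact W.2 x
    have e : Matrix.of (fun i => G i ᵥ* V) = Matrix.of G * V := by
      ext i j; rfl
    rw [e, Matrix.mul_assoc]
    exact minEnergy_le G hVW
  refine le_antisymm ?_ (key U hU G)
  have h := key (star U) (Unitary.star_mem hU) (fun i => G i ᵥ* U)
  simpa [Matrix.vecMul_vecMul, Unitary.mul_star_self_of_mem hU] using h

/-- Least squares in one variable: the choice of the coefficient `c` for the new coordinate. -/
lemma sqNorm_regression {n : ℕ} (a : ℂ) (g T : Fin n → ℂ) :
    ‖a * (-(star g ⬝ᵥ T) / (‖a‖ ^ 2 + sqNorm g : ℝ))‖ ^ 2 +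
      sqNorm (fun i => g i * (-(star g ⬝ᵥ T) / (‖a‖ ^ 2 + sqNorm g : ℝ)) + T i) =
        sqNorm T - ‖star g ⬝ᵥ T‖ ^ 2 / (‖a‖ ^ 2 + sqNorm g) := by
  set D := ‖a‖ ^ 2 + sqNorm g with hD
  set t := star g ⬝ᵥ T with ht
  set c : ℂ := -t / (D : ℝ) with hc
  have hexp : sqNorm (fun i => g i * c + T i) =
      ‖c‖ ^ 2 * sqNorm g + 2 * ((starRingEnd ℂ) c * t).re + sqNorm T := by
    rw [ht]
    simp only [sqNorm, dotProduct, Finset.mul_sum, Complex.re_sum, ← Finset.sum_add_distrib]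
    refine Finset.sum_congr rfl fun i _ => ?_
    simp only [Complex.sq_norm, Complex.normSq_apply, Pi.star_apply, RCLike.star_def]
    simp
    ring
  have hcn : ‖c‖ ^ 2 = ‖t‖ ^ 2 / D ^ 2 := by
    rw [hc, norm_div, norm_neg, div_pow, Complex.norm_real, Real.norm_eq_abs, sq_abs]
  have hct : ((starRingEnd ℂ) c * t).re = - (‖t‖ ^ 2 / D) := by
    have : (starRingEnd ℂ) c * t = ((-(‖t‖ ^ 2 / D) : ℝ) : ℂ) := by
      rw [hc, map_div₀, map_neg, Complex.conj_ofReal]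
      push_cast
      rw [← Complex.conj_mul']
      ring
    rw [this, Complex.ofReal_re]
  rw [hexp, norm_mul, mul_pow, hcn, hct]
  rcases eq_or_ne D 0 with h0 | h0
  · simp [h0]
  · have : ‖a‖ ^ 2 = D - sqNorm g := by rw [hD]; ring
    rw [this]
    field_simp
    ring

/-- Every test matrix `W` for `G` extends to one for the bordered matrix, and the energy of each
column drops by the part explained by the new column `g`. -/
lemma minEnergy_bordered_le {n K : ℕ} (a : ℂ) (g : Fin n → ℂ) (G : Fin n → Fin n → ℂ)
    {W : Matrix (Fin n) (Fin K) ℂ} (hW : W ∈ Expanding n K) :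
    minEnergy K (bordered a g G) ≤ ENNReal.ofReal (∑ j, (sqNorm ((Matrix.of G * W).col j) -
      ‖star g ⬝ᵥ (Matrix.of G * W).col j‖ ^ 2 / (‖a‖ ^ 2 + sqNorm g))) := by
  set T := (Matrix.of G * W).col
  let c : Fin K → ℂ := fun j => -(star g ⬝ᵥ T j) / (‖a‖ ^ 2 + sqNorm g : ℝ)
  let W' : Matrix (Fin (n + 1)) (Fin K) ℂ := Matrix.of (Fin.cons c W)
  have hW0 : ∀ j, W' 0 j = c j := fun _ => rfl
  have hWs : ∀ i j, W' (Fin.succ i) j = W i j := fun _ _ => rfl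
  have hmul : ∀ x, W' *ᵥ x = Fin.cons (c ⬝ᵥ x) (W *ᵥ x) := fun x => by
    ext i
    refine Fin.cases ?_ (fun i => ?_) i <;> simp [W', Matrix.mulVec] <;> rfl
  have hW' : W' ∈ Expanding (n + 1) K := fun x => by
    rw [hmul, sqNorm_cons]
    exact (hW x).trans (le_add_of_nonneg_left (by positivity))
  refine (minEnergy_le _ hW').trans (ENNReal.ofReal_le_ofReal (le_of_eq ?_))
  unfold frobSq
  refine Finset.sum_congr rfl fun j _ => ?_
  rw [← sqNorm_regression, ← sqNorm_cons]
  congr 1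
  ext i
  refine Fin.cases ?_ (fun i => ?_) i
  · rw [Matrix.col_apply, Matrix.mul_apply, Fin.sum_univ_succ, hW0]
    simp [bordered, c]
  · rw [Matrix.col_apply, Matrix.mul_apply, Fin.sum_univ_succ, hW0]
    simp only [hWs]
    simp [bordered, c, T, Matrix.mul_apply]

/-- The first `K` columns of the identity matrix. -/
def firstColumns (n K : ℕ) : Matrix (Fin n) (Fin K) ℂ :=
  Matrix.of fun i j => if (i : ℕ) = j then 1 else 0

lemma firstColumns_mem {n K : ℕ} (h : K ≤ n) : firstColumns n K ∈ Expanding n K := by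
  intro x
  have hx : ∀ j : Fin K, (firstColumns n K *ᵥ x) (Fin.castLE h j) = x j := fun j => by
    simp [firstColumns, Matrix.mulVec, dotProduct, Fin.val_inj]
  unfold sqNorm
  calc ∑ j, ‖x j‖ ^ 2 = ∑ j, ‖(firstColumns n K *ᵥ x) (Fin.castLE h j)‖ ^ 2 := by simp only [hx]
    _ = ∑ i ∈ Finset.univ.map (Fin.castLEEmb h), ‖(firstColumns n K *ᵥ x) i‖ ^ 2 := by
      rw [Finset.sum_map]; rfl
    _ ≤ _ := Finset.sum_le_sum_of_subset_of_nonneg (Finset.subset_univ _)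
      fun _ _ _ => by positivity

lemma minEnergy_le_norm {n K : ℕ} (h : K ≤ n) (G : Fin n → Fin n → ℂ) :
    minEnergy K G ≤ ENNReal.ofReal (K * n * ‖G‖ ^ 2) := by
  refine (minEnergy_le G (firstColumns_mem h)).trans (ENNReal.ofReal_le_ofReal ?_)
  have hx : ∀ i j, (Matrix.of G * firstColumns n K) i j = G i (Fin.castLE h j) := fun i j => by
    rw [Matrix.mul_apply, Finset.sum_eq_single (Fin.castLE h j)]
    · simp [firstColumns]
    · intro k _ hk
      have : (k : ℕ) ≠ j := fun e => hk (Fin.ext e)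
      simp [firstColumns, this]
    · simp
  unfold frobSq sqNorm
  calc ∑ j, ∑ i, ‖(Matrix.of G * firstColumns n K).col j i‖ ^ 2
      ≤ ∑ _j : Fin K, ∑ _i : Fin n, ‖G‖ ^ 2 := by
        refine Finset.sum_le_sum fun j _ => Finset.sum_le_sum fun i _ => ?_
        rw [Matrix.col_apply, hx]
        gcongr
        exact (norm_le_pi_norm (G i) _).trans (norm_le_pi_norm G i)
    _ = _ := by simp [mul_assoc]

/-! ### Decay of the moments of the least energy -/

/-- Jensen's inequality for the eighth power, with weights that need not sum to one. -/
lemma sum_mul_pow_le {ι : Type*} [Fintype ι] {w y : ι → ℝ} (hw : ∀ i, 0 ≤ w i)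
    (hy : ∀ i, 0 ≤ y i) :
    (∑ i, w i * y i) ^ 8 ≤ (∑ i, w i) ^ 7 * ∑ i, w i * y i ^ 8 := by
  rcases (Finset.sum_nonneg fun i (_ : i ∈ Finset.univ) => hw i).eq_or_lt with h | h
  · have h0 : ∀ i, w i = 0 := fun i =>
      (Finset.sum_eq_zero_iff_of_nonneg fun i _ => hw i).1 h.symm i (Finset.mem_univ i)
    simp [h0]
  set S := ∑ i, w i with hS
  have := Real.pow_arith_mean_le_arith_mean_pow Finset.univ (fun i => w i / S) y
    (fun i _ => by have := hw i; positivity) (by rw [← Finset.sum_div, div_self h.ne'])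
    (fun i _ => hy i) 8
  simp only [div_mul_eq_mul_div, ← Finset.sum_div, div_pow] at this
  rw [div_le_div_iff₀ (by positivity) h] at this
  have h2 : (∑ i, w i * y i) ^ 8 * S ≤ (S ^ 7 * ∑ i, w i * y i ^ 8) * S := by
    refine this.trans (le_of_eq ?_)
    ring
  exact le_of_mul_le_mul_right h2 h

lemma continuous_bordered {n : ℕ} :
    Continuous fun p : ℂ × (Fin n → ℂ) × (Fin n → Fin n → ℂ) => bordered p.1 p.2.1 p.2.2 := by
  unfold bordered
  refine continuous_pi fun i => continuous_pi fun j => ?_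
  refine Fin.cases ?_ (fun i => ?_) i <;> refine Fin.cases ?_ (fun j => ?_) j <;>
    simp only [Fin.cons_zero, Fin.cons_succ, Pi.zero_apply] <;> fun_prop

/-- The energy bound for the bordered matrix, with every column rotated to the first coordinate. -/
lemma minEnergy_bordered_pow_le {m K : ℕ} (G : Fin (m + 1) → Fin (m + 1) → ℂ)
    {W : Matrix (Fin (m + 1)) (Fin K) ℂ} (hW : W ∈ Expanding (m + 1) K) :
    ∃ U : Fin K → Matrix (Fin (m + 1)) (Fin (m + 1)) ℂ,
      (∀ j, U j ∈ Matrix.unitaryGroup (Fin (m + 1)) ℂ) ∧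
      ∀ (r : Fin (m + 2) → ℂ) (g : Fin (m + 1) → ℂ),
        minEnergy K (bordered ((√(sqNorm r) : ℝ) : ℂ) g G) ^ 8 ≤
          ENNReal.ofReal (frobSq (Matrix.of G * W) ^ 7) *
            ∑ j, ENNReal.ofReal (sqNorm ((Matrix.of G * W).col j)) *
              ENNReal.ofReal ((1 - ‖(g ᵥ* U j) 0‖ ^ 2 / (sqNorm r + sqNorm (g ᵥ* U j))) ^ 8) := by
  set T := (Matrix.of G * W).col
  choose U hU h using fun j => exists_unitary_dotProduct (T j)
  refine ⟨U, hU, fun r g => ?_⟩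
  have h1 := minEnergy_bordered_le ((√(sqNorm r) : ℝ) : ℂ) g G hW
  have hr : ‖((√(sqNorm r) : ℝ) : ℂ)‖ ^ 2 = sqNorm r := by
    rw [Complex.norm_real, Real.norm_eq_abs, sq_abs, Real.sq_sqrt (sqNorm_nonneg r)]
  rw [hr] at h1
  set y : Fin K → ℝ := fun j => 1 - ‖(g ᵥ* U j) 0‖ ^ 2 / (sqNorm r + sqNorm (g ᵥ* U j)) with hy
  have hy0 : ∀ j, 0 ≤ y j := fun j => by
    have : ‖(g ᵥ* U j) 0‖ ^ 2 / (sqNorm r + sqNorm (g ᵥ* U j)) ≤ 1 := by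
      apply div_le_one_of_le₀
      · exact (sq_norm_le_sqNorm _ 0).trans (le_add_of_nonneg_left (sqNorm_nonneg r))
      · exact add_nonneg (sqNorm_nonneg _) (sqNorm_nonneg _)
    simp only [hy]
    linarith
  have h2 : ∀ j, sqNorm (T j) - ‖star g ⬝ᵥ T j‖ ^ 2 / (sqNorm r + sqNorm g) =
      sqNorm (T j) * y j := fun j => by
    simp only [hy]
    rw [h, sqNorm_vecMul_unitary (hU j)]
    ring
  change minEnergy K _ ≤ ENNReal.ofReal (∑ j, (sqNorm (T j) -
    ‖star g ⬝ᵥ T j‖ ^ 2 / (sqNorm r + sqNorm g))) at h1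
  simp only [h2] at h1
  have hterm : ∀ j, 0 ≤ sqNorm (T j) * y j ^ 8 := fun j =>
    mul_nonneg (sqNorm_nonneg _) (pow_nonneg (hy0 j) 8)
  calc _ ≤ ENNReal.ofReal (∑ j, sqNorm (T j) * y j) ^ 8 := by gcongr
    _ = ENNReal.ofReal ((∑ j, sqNorm (T j) * y j) ^ 8) :=
      (ENNReal.ofReal_pow (Finset.sum_nonneg fun j _ => mul_nonneg (sqNorm_nonneg _) (hy0 j)) 8).symm
    _ ≤ ENNReal.ofReal ((∑ j, sqNorm (T j)) ^ 7 * ∑ j, sqNorm (T j) * y j ^ 8) :=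
      ENNReal.ofReal_le_ofReal (sum_mul_pow_le (fun j => sqNorm_nonneg _) hy0)
    _ = _ := by
      rw [ENNReal.ofReal_mul (pow_nonneg (Finset.sum_nonneg fun j _ => sqNorm_nonneg _) 7),
        ENNReal.ofReal_sum_of_nonneg fun j _ => hterm j]
      congr 1
      refine Finset.sum_congr rfl fun j _ => ?_
      rw [ENNReal.ofReal_mul (sqNorm_nonneg _)]

/-- One step of the recursion, for a fixed lower right block. -/
lemma lintegral_minEnergy_bordered_le {m K : ℕ} (hK : K ≤ m + 1) {ρ : ℝ≥0∞} (hρ : ρ ≠ ∞)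
    (h : ∫⁻ r, ∫⁻ g, ENNReal.ofReal ((1 - ‖g 0‖ ^ 2 / (sqNorm r + sqNorm g)) ^ 8)
      ∂gaussianVector (m + 1) ∂gaussianVector (m + 2) ≤ ρ)
    (G : Fin (m + 1) → Fin (m + 1) → ℂ) :
    ∫⁻ r, ∫⁻ g, minEnergy K (bordered ((√(sqNorm r) : ℝ) : ℂ) g G) ^ 8
      ∂gaussianVector (m + 1) ∂gaussianVector (m + 2) ≤ ρ * minEnergy K G ^ 8 := by
  have key : ∀ W : Expanding (m + 1) K,
      ∫⁻ r, ∫⁻ g, minEnergy K (bordered ((√(sqNorm r) : ℝ) : ℂ) g G) ^ 8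
        ∂gaussianVector (m + 1) ∂gaussianVector (m + 2) ≤
          ρ * ENNReal.ofReal (frobSq (Matrix.of G * W.1)) ^ 8 := by
    rintro ⟨W, hW⟩
    obtain ⟨U, hU, hle⟩ := minEnergy_bordered_pow_le G hW
    set T := (Matrix.of G * W).col
    set S := ENNReal.ofReal (frobSq (Matrix.of G * W) ^ 7) with hS
    let F : (Fin (m + 2) → ℂ) → (Fin (m + 1) → ℂ) → ℝ≥0∞ := fun r g =>
      ENNReal.ofReal ((1 - ‖g 0‖ ^ 2 / (sqNorm r + sqNorm g)) ^ 8)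
    have hF : ∀ r, Measurable (F r) := fun r => by fun_prop
    have hF2 : Measurable fun r => ∫⁻ g, F r g ∂gaussianVector (m + 1) :=
      Measurable.lintegral_prod_right' (f := fun p : (Fin (m + 2) → ℂ) × (Fin (m + 1) → ℂ) =>
        ENNReal.ofReal ((1 - ‖p.2 0‖ ^ 2 / (sqNorm p.1 + sqNorm p.2)) ^ 8)) (by fun_prop)
    have hmv : ∀ j, MeasurePreserving (fun g => g ᵥ* U j) (gaussianVector (m + 1))
        (gaussianVector (m + 1)) := fun j => measurePreserving_vecMul_unitary 1 (hU j)
    have hcomp : ∀ r j, Measurable fun g => F r (g ᵥ* U j) := fun r j =>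
      (hF r).comp (hmv j).measurable
    calc _ ≤ ∫⁻ r, ∫⁻ g, S * ∑ j, ENNReal.ofReal (sqNorm (T j)) * F r (g ᵥ* U j)
          ∂gaussianVector (m + 1) ∂gaussianVector (m + 2) :=
          lintegral_mono fun r => lintegral_mono fun g => hle r g
      _ = ∫⁻ r, S * ∑ j, ENNReal.ofReal (sqNorm (T j)) * ∫⁻ g, F r g ∂gaussianVector (m + 1)
          ∂gaussianVector (m + 2) := by
        refine lintegral_congr fun r => ?_
        rw [lintegral_const_mul _ (Finset.measurable_fun_sum _ fun j _ => (hcomp r j).const_mul _),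
          lintegral_finsetSum _ fun j _ => (hcomp r j).const_mul _]
        congr 1
        refine Finset.sum_congr rfl fun j _ => ?_
        rw [lintegral_const_mul _ (hcomp r j), (hmv j).lintegral_comp (hF r)]
      _ = S * ∑ j, ENNReal.ofReal (sqNorm (T j)) *
          ∫⁻ r, ∫⁻ g, F r g ∂gaussianVector (m + 1) ∂gaussianVector (m + 2) := by
        rw [lintegral_const_mul _ (Finset.measurable_fun_sum _ fun j _ => hF2.const_mul _),
          lintegral_finsetSum _ fun j _ => hF2.const_mul _]
        congr 1
        exact Finset.sum_congr rfl fun j _ => lintegral_const_mul _ hF2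
      _ ≤ S * ∑ j, ENNReal.ofReal (sqNorm (T j)) * ρ := by gcongr
      _ = ρ * ENNReal.ofReal (frobSq (Matrix.of G * W)) ^ 8 := by
        rw [← Finset.sum_mul, ← ENNReal.ofReal_sum_of_nonneg fun j _ => sqNorm_nonneg _, hS,
          ENNReal.ofReal_pow (frobSq_nonneg _)]
        change ENNReal.ofReal (frobSq (Matrix.of G * W)) ^ 7 *
          (ENNReal.ofReal (frobSq (Matrix.of G * W)) * ρ) = _
        ring
  have : Nonempty (Expanding (m + 1) K) := ⟨⟨_, firstColumns_mem hK⟩⟩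
  have hmono : Monotone fun x : ℝ≥0∞ => ρ * x ^ 8 := fun x y hxy => by
    simp only
    gcongr
  have hcont : Continuous fun x : ℝ≥0∞ => ρ * x ^ 8 :=
    (ENNReal.continuous_const_mul hρ).comp (ENNReal.continuous_pow 8)
  have hinf := hmono.map_ciInf_of_continuousAt
    (g := fun W : Expanding (m + 1) K => ENNReal.ofReal (frobSq (Matrix.of G * W.1)))
    hcont.continuousAt (OrderBot.bddBelow _)
  exact (le_iInf key).trans hinf.ge

lemma lintegral_minEnergy_succ_le {m K : ℕ} (hK : K ≤ m + 1) {ρ : ℝ≥0∞} (hρ : ρ ≠ ∞)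
    (h : ∫⁻ r, ∫⁻ g, ENNReal.ofReal ((1 - ‖g 0‖ ^ 2 / (sqNorm r + sqNorm g)) ^ 8)
      ∂gaussianVector (m + 1) ∂gaussianVector (m + 2) ≤ ρ) :
    ∫⁻ G, minEnergy K G ^ 8 ∂gaussianSquare (m + 2) ≤
      ρ * ∫⁻ G, minEnergy K G ^ 8 ∂gaussianSquare (m + 1) := by
  rw [lintegral_gaussianSquare_succ (by fun_prop) fun U hU G => by rw [minEnergy_mul_unitary hU],
    lintegral_lintegral_swap]
  · rw [← lintegral_const_mul _ (by fun_prop)]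
    exact lintegral_mono fun G => lintegral_minEnergy_bordered_le hK hρ h G
  · refine Measurable.aemeasurable (Measurable.lintegral_prod_right' (f := fun p :
      ((Fin (m + 2) → ℂ) × (Fin (m + 1) → Fin (m + 1) → ℂ)) × (Fin (m + 1) → ℂ) =>
        minEnergy K (bordered ((√(sqNorm p.1.1) : ℝ) : ℂ) p.2 p.1.2) ^ 8) ?_)
    refine Measurable.pow_const ((measurable_minEnergy K).comp ?_) 8
    refine Continuous.measurable (continuous_bordered.comp (f := fun p :
      ((Fin (m + 2) → ℂ) × (Fin (m + 1) → Fin (m + 1) → ℂ)) × (Fin (m + 1) → ℂ) =>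
        (((√(sqNorm p.1.1) : ℝ) : ℂ), p.2, p.1.2)) ?_)
    fun_prop

lemma lintegral_minEnergy_lt_top {n K : ℕ} (hK : K ≤ n) :
    ∫⁻ G, minEnergy K G ^ 8 ∂gaussianSquare n < ∞ := by
  have hi : Integrable (fun G => (K * n * ‖G‖ ^ 2) ^ 8) (gaussianSquare n) := by
    have := (IsGaussian.integrable_norm_pow (gaussianSquare n) 16).const_mul ((K * n : ℝ) ^ 8)
    refine this.congr (Eventually.of_forall fun G => ?_)
    simp only
    ring
  refine lt_of_le_of_lt (lintegral_mono fun G => ?_) hi.lintegral_lt_top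
  rw [ENNReal.ofReal_pow (by positivity)]
  exact pow_le_pow_left' (minEnergy_le_norm hK G) 8

/-- The eighth moment of the least energy decays at least like `n⁻²`. -/
lemma exists_lintegral_minEnergy_le (K : ℕ) : ∃ (B : ℝ) (n₀ : ℕ), 0 ≤ B ∧ ∀ n, n₀ ≤ n →
    ∫⁻ G, minEnergy K G ^ 8 ∂gaussianSquare (n + 2) ≤ ENNReal.ofReal (B / (n + 1) ^ 2) := by
  obtain ⟨C, hC0, hC⟩ := exists_contraction_bound
  obtain ⟨k, hk⟩ := exists_nat_ge C
  set n₀ := max K k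
  set I₀ := (∫⁻ G, minEnergy K G ^ 8 ∂gaussianSquare (n₀ + 2)).toReal with hI
  refine ⟨I₀ * (n₀ + 1) ^ 2, n₀, by positivity, fun n hn => ?_⟩
  induction n, hn using Nat.le_induction with
  | base =>
    rw [mul_div_assoc, div_self (by positivity), mul_one, hI, ENNReal.ofReal_toReal]
    exact (lintegral_minEnergy_lt_top (by grind)).ne
  | succ n hn ih =>
    have hKn : K ≤ n + 1 + 1 := by grind
    have hCn : C ≤ n := hk.trans (by exact_mod_cast (le_max_right K k).trans hn)
    refine (lintegral_minEnergy_succ_le hKn ENNReal.ofReal_ne_top (hC (n + 1))).trans ?_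
    refine (mul_le_mul_right ih _).trans ?_
    rw [← ENNReal.ofReal_mul' (by positivity)]
    apply ENNReal.ofReal_le_ofReal
    push_cast
    have hx : (0 : ℝ) < n + 1 := by positivity
    -- with `N = n + 2`, the factor is at most `((N - 1) / N) ^ 2`
    have hfac : 1 - 4 / ((n : ℝ) + 1 + 1) + C / (n + 1 + 1) ^ 2 ≤
        (n + 1) ^ 2 / (n + 1 + 1) ^ 2 := by
      rw [← sub_nonneg]
      have : ((n : ℝ) + 1) ^ 2 / (n + 1 + 1) ^ 2 -
          (1 - 4 / ((n : ℝ) + 1 + 1) + C / (n + 1 + 1) ^ 2)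
          = (2 * n + 5 - C) / (n + 1 + 1) ^ 2 := by
        field_simp
        ring
      rw [this]
      apply div_nonneg _ (by positivity)
      linarith
    refine (mul_le_mul_of_nonneg_right hfac (by positivity)).trans (le_of_eq ?_)
    field_simp

/-! ### Singular values -/

lemma norm_sq_toEuclideanLin {n : ℕ} (A : Matrix (Fin n) (Fin n) ℂ) (x : Fin n → ℂ) :
    ‖Matrix.toEuclideanLin A (WithLp.toLp 2 x)‖ ^ 2 = sqNorm (A *ᵥ x) := by
  rw [sqNorm_eq_norm_sq (A *ᵥ x)]
  rfl

/-- The squared norm of the image of a vector, in terms of the coordinates of the vector in an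
orthonormal basis of right singular vectors. -/
lemma exists_basis_norm_sq_eq {E F : Type*} [NormedAddCommGroup E] [InnerProductSpace ℂ E]
    [FiniteDimensional ℂ E] [NormedAddCommGroup F] [InnerProductSpace ℂ F]
    [FiniteDimensional ℂ F] {n : ℕ} (hn : Module.finrank ℂ E = n) (T : E →ₗ[ℂ] F) :
    ∃ b : OrthonormalBasis (Fin n) ℂ E,
      ∀ x, ‖T x‖ ^ 2 = ∑ i : Fin n, T.singularValues i ^ 2 * ‖b.repr x i‖ ^ 2 := by
  have hT := T.isSymmetric_adjoint_comp_self
  refine ⟨hT.eigenvectorBasis hn, fun x => ?_⟩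
  set b := hT.eigenvectorBasis hn with hb
  have h1 : ((‖T x‖ ^ 2 : ℝ) : ℂ) = inner ℂ x ((T.adjoint ∘ₗ T) x) := by
    rw [LinearMap.comp_apply, LinearMap.adjoint_inner_right, inner_self_eq_norm_sq_to_K]
    push_cast
    rfl
  have h2 : ((‖T x‖ ^ 2 : ℝ) : ℂ) =
      ((∑ i : Fin n, T.singularValues i ^ 2 * ‖b.repr x i‖ ^ 2 : ℝ) : ℂ) := by
    rw [h1, ← b.repr.inner_map_map, PiLp.inner_apply, Complex.ofReal_sum]
    refine Finset.sum_congr rfl fun i _ => ?_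
    rw [hb, hT.eigenvectorBasis_apply_self_apply hn, ← T.sq_singularValues_fin hn i]
    rw [RCLike.inner_apply, Complex.ofReal_mul, Complex.ofReal_pow ‖_‖, ← Complex.conj_mul']
    exact (mul_assoc _ _ _).trans (congrArg _ (mul_comm _ _))
  exact_mod_cast h2

lemma sqNorm_mulVec_le {n K : ℕ} (B : Matrix (Fin n) (Fin K) ℂ) (x : Fin K → ℂ) :
    sqNorm (B *ᵥ x) ≤ frobSq B * sqNorm x := by
  have h : ∀ i, ‖(B *ᵥ x) i‖ ^ 2 ≤ (∑ j, ‖B i j‖ ^ 2) * sqNorm x := fun i => by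
    calc ‖(B *ᵥ x) i‖ ^ 2 ≤ (∑ j, ‖B i j‖ * ‖x j‖) ^ 2 := by
          gcongr
          refine (norm_sum_le Finset.univ fun j => B i j * x j).trans (le_of_eq ?_)
          simp
      _ ≤ _ := Finset.sum_mul_sq_le_sq_mul_sq _ _ _
  have hB : frobSq B = ∑ i, ∑ j, ‖B i j‖ ^ 2 := by
    rw [Finset.sum_comm]; rfl
  rw [hB, Finset.sum_mul]
  exact Finset.sum_le_sum fun i _ => h i

/-- The easy half of the min-max principle: the span of `K` columns meets the span of the first
`n - K + 1` right singular vectors. -/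
lemma sq_singularValues_le_frobSq {n K : ℕ} (hK : 0 < K) (hKn : K ≤ n)
    (A : Matrix (Fin n) (Fin n) ℂ) {W : Matrix (Fin n) (Fin K) ℂ} (hW : W ∈ Expanding n K) :
    (Matrix.toEuclideanLin A).singularValues (n - K) ^ 2 ≤ frobSq (A * W) := by
  set T := Matrix.toEuclideanLin A
  obtain ⟨b, hb⟩ := exists_basis_norm_sq_eq (n := n) (by simp) T
  set s := T.singularValues (n - K) with hs
  -- the coordinates that vanish on the span of the first `n - K + 1` singular vectors
  let Φ : (Fin K → ℂ) →ₗ[ℂ] (Fin (K - 1) → ℂ) := LinearMap.pi fun i =>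
    (innerₛₗ ℂ (b ⟨n - K + 1 + i, by omega⟩)) ∘ₗ
      (WithLp.linearEquiv 2 ℂ (Fin n → ℂ)).symm.toLinearMap ∘ₗ W.mulVecLin
  have hΦ : Φ.ker ≠ ⊥ := LinearMap.ker_ne_bot_of_finrank_lt (by simpa using hK)
  obtain ⟨x, hx, hx0⟩ := Submodule.exists_mem_ne_zero_of_ne_bot hΦ
  set y : EuclideanSpace ℂ (Fin n) := WithLp.toLp 2 (W *ᵥ x) with hy
  have hrepr : ∀ i : Fin n, n - K < i → b.repr y i = 0 := fun i hi => by
    have h := congrFun (LinearMap.mem_ker.1 hx) ⟨i - (n - K + 1), by omega⟩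
    have hi' : (⟨n - K + 1 + (i - (n - K + 1)), by omega⟩ : Fin n) = i := Fin.ext (by simp; omega)
    rw [b.repr_apply_apply]
    simpa [Φ, hi'] using h
  have hx1 : 0 < sqNorm x := (sqNorm_nonneg x).lt_of_ne fun h => hx0 (sqNorm_eq_zero.1 h.symm)
  have h1 : s ^ 2 * sqNorm x ≤ frobSq (A * W) * sqNorm x := by
    calc s ^ 2 * sqNorm x ≤ s ^ 2 * sqNorm (W *ᵥ x) := by gcongr; exact hW x
      _ = ∑ i, s ^ 2 * ‖b.repr y i‖ ^ 2 := by
        rw [sqNorm_eq_norm_sq (W *ᵥ x), ← hy, ← b.repr.norm_map, EuclideanSpace.norm_sq_eq,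
          Finset.mul_sum]
      _ ≤ ∑ i : Fin n, T.singularValues i ^ 2 * ‖b.repr y i‖ ^ 2 := by
        refine Finset.sum_le_sum fun i _ => ?_
        rcases lt_or_ge (n - K) (i : ℕ) with h | h
        · simp [hrepr i h]
        · have := T.singularValues_antitone h
          have := T.singularValues_nonneg (n - K)
          gcongr
      _ = sqNorm ((A * W) *ᵥ x) := by
        rw [← hb, hy, norm_sq_toEuclideanLin, Matrix.mulVec_mulVec]
      _ ≤ _ := sqNorm_mulVec_le _ _
  exact le_of_mul_le_mul_right h1 hx1

lemma sqNorm_col_le_sq_singularValues {n : ℕ} (A : Matrix (Fin n) (Fin n) ℂ) (j : Fin n) :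
    sqNorm (A.col j) ≤ (Matrix.toEuclideanLin A).singularValues 0 ^ 2 := by
  set T := Matrix.toEuclideanLin A
  obtain ⟨b, hb⟩ := exists_basis_norm_sq_eq (n := n) (by simp) T
  set e : EuclideanSpace ℂ (Fin n) := WithLp.toLp 2 (Pi.single j 1) with he
  have h1 : sqNorm (A.col j) = ‖T e‖ ^ 2 := by
    rw [he, norm_sq_toEuclideanLin, Matrix.mulVec_single_one]
  have h2 : ‖e‖ = 1 := by simp [he]
  rw [h1, hb]
  calc _ ≤ ∑ i, T.singularValues 0 ^ 2 * ‖b.repr e i‖ ^ 2 := by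
        refine Finset.sum_le_sum fun i _ => ?_
        have := T.singularValues_antitone (Nat.zero_le i)
        have := T.singularValues_nonneg i
        gcongr
    _ = T.singularValues 0 ^ 2 := by
      rw [← Finset.mul_sum, ← EuclideanSpace.norm_sq_eq, b.repr.norm_map, h2]
      simp

lemma singularValues_pos_of_det_ne_zero {n : ℕ} {A : Matrix (Fin n) (Fin n) ℂ} (hA : A.det ≠ 0)
    {i : ℕ} (hi : i < n) : 0 < (Matrix.toEuclideanLin A).singularValues i := by
  refine (LinearMap.injective_iff_forall_lt_finrank_singularValues_pos _).1 ?_ i (by simpa using hi)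
  rw [← LinearMap.ker_eq_bot, LinearMap.ker_eq_bot']
  intro v hv
  have h : A *ᵥ v.ofLp = 0 := congrArg WithLp.ofLp hv
  by_contra h0
  exact hA (Matrix.exists_mulVec_eq_zero_iff.1 ⟨v.ofLp, by simpa using h0, h⟩)

/-- The `K`-th smallest singular value is controlled by the least energy, here with a scalar factor
to pass from normalized to standard Gaussian entries. -/
lemma ofReal_sq_singularValues_le_minEnergy {n K : ℕ} (hK : 0 < K) (hKn : K ≤ n) (c : ℝ)
    (A : Matrix (Fin n) (Fin n) ℂ) :
    ENNReal.ofReal (c ^ 2 * (Matrix.toEuclideanLin A).singularValues (n - K) ^ 2) ≤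
      minEnergy K fun i j => (c : ℂ) * A i j := by
  refine le_iInf fun W => ENNReal.ofReal_le_ofReal ?_
  have h : frobSq (Matrix.of (fun i j => (c : ℂ) * A i j) * W.1) = c ^ 2 * frobSq (A * W.1) := by
    have e : Matrix.of (fun i j => (c : ℂ) * A i j) * W.1 = (c : ℂ) • (A * W.1) := by
      rw [← Matrix.smul_mul]; rfl
    rw [e]
    unfold frobSq
    rw [Finset.mul_sum]
    refine Finset.sum_congr rfl fun j _ => ?_
    have : ((c : ℂ) • (A * W.1)).col j = (c : ℂ) • (A * W.1).col j := rfl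
    rw [this, sqNorm_smul, Complex.norm_real, Real.norm_eq_abs, sq_abs]
  rw [h]
  have := sq_singularValues_le_frobSq hK hKn A W.2
  gcongr

/-! ### Almost sure properties of one Gaussian matrix -/

lemma measurePreserving_re_complexGaussian (v : ℝ≥0) :
    MeasurePreserving Complex.re (complexGaussian v) (gaussianReal 0 (v / 2)) := by
  refine ⟨Complex.measurable_re, ?_⟩
  have hm : Measurable fun z : ℝ × ℝ => (⟨z.1, z.2⟩ : ℂ) :=
    Complex.equivRealProdCLM.symm.continuous.measurable
  rw [complexGaussian, Measure.map_map Complex.measurable_re hm]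
  exact measurePreserving_fst.map_eq

lemma complexGaussian_singleton_zero : complexGaussian 1 {0} = 0 := by
  have h := (measurePreserving_re_complexGaussian 1).measure_preimage
    (measurableSet_singleton (0 : ℝ)).nullMeasurableSet
  have := nullSingletonClass_gaussianReal (μ := 0) (v := 1 / 2) (by norm_num)
  rw [measure_singleton] at h
  exact measure_mono_null (by intro z hz; simp [Set.mem_singleton_iff.1 hz]) h

lemma complexGaussian_closedBall_lt_one (M : ℝ) :
    complexGaussian 1 {z | ‖z‖ ^ 2 ≤ M} < 1 := by
  have hp : 0 < gaussianReal 0 (1 / 2) (Set.Ioi √M) := by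
    rw [pos_iff_ne_zero]
    intro h
    have := gaussianReal_absolutelyContinuous' 0 (v := 1 / 2) (by norm_num) h
    simp at this
  have h := (measurePreserving_re_complexGaussian 1).measure_preimage
    (measurableSet_Ioi (a := √M)).nullMeasurableSet
  have hle : complexGaussian 1 {z | ‖z‖ ^ 2 ≤ M} ≤
      complexGaussian 1 (Complex.re ⁻¹' Set.Ioi √M)ᶜ := by
    refine measure_mono fun z hz => ?_
    simp only [Set.mem_compl_iff, Set.mem_preimage, Set.mem_Ioi, not_lt]
    exact (Complex.re_le_norm z).trans (Real.le_sqrt_of_sq_le hz)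
  refine hle.trans_lt ?_
  rw [prob_compl_eq_one_sub (Complex.measurable_re measurableSet_Ioi), h]
  exact ENNReal.sub_lt_self ENNReal.one_ne_top one_ne_zero hp.ne'

lemma gaussianVector_eval (n : ℕ) (j : Fin n) :
    MeasurePreserving (fun r => r j) (gaussianVector n) (complexGaussian 1) :=
  measurePreserving_eval (fun _ : Fin n => complexGaussian 1) j

lemma ae_ne_zero_gaussianVector (n : ℕ) : ∀ᵐ r ∂gaussianVector (n + 1), r ≠ 0 := by
  have h := (gaussianVector_eval (n + 1) 0).measure_preimage
    (measurableSet_singleton (0 : ℂ)).nullMeasurableSet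
  rw [complexGaussian_singleton_zero] at h
  refine measure_mono_null (fun r hr => ?_) h
  have : r = 0 := by simpa using hr
  simp [this]

/-- All entries of the first column are small with exponentially small probability. -/
lemma gaussianSquare_column_le (M : ℝ) (m : ℕ) :
    gaussianSquare (m + 1) {G | ∀ i, ‖G i 0‖ ^ 2 ≤ M} =
      complexGaussian 1 {z | ‖z‖ ^ 2 ≤ M} ^ (m + 1) := by
  have hs : {G : Fin (m + 1) → Fin (m + 1) → ℂ | ∀ i, ‖G i 0‖ ^ 2 ≤ M} =
      Set.univ.pi fun _ => {r | ‖r 0‖ ^ 2 ≤ M} := by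
    ext G; simp
  have hr : gaussianVector (m + 1) {r | ‖r 0‖ ^ 2 ≤ M} = complexGaussian 1 {z | ‖z‖ ^ 2 ≤ M} :=
    (gaussianVector_eval (m + 1) 0).measure_preimage (s := {z | ‖z‖ ^ 2 ≤ M})
      (measurableSet_le (by fun_prop) measurable_const).nullMeasurableSet
  rw [hs, gaussianSquare, Measure.pi_pi]
  simp [hr]

lemma measurable_det {n : ℕ} :
    Measurable fun G : Fin n → Fin n → ℂ => (Matrix.of G).det := by
  refine Continuous.measurable (Continuous.matrix_det (A := fun G => Matrix.of G) ?_)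
  exact continuous_id

lemma det_bordered {n : ℕ} (a : ℂ) (g : Fin n → ℂ) (G : Fin n → Fin n → ℂ) :
    (Matrix.of (bordered a g G)).det = a * (Matrix.of G).det := by
  rw [Matrix.det_succ_row_zero, Fin.sum_univ_succ]
  have : (Matrix.of (bordered a g G)).submatrix Fin.succ (Fin.succAbove 0) = Matrix.of G := by
    ext i j
    simp [bordered]
  rw [this]
  simp [bordered]

/-- A Gaussian matrix is almost surely invertible. -/
lemma ae_det_ne_zero (n : ℕ) : ∀ᵐ G ∂gaussianSquare n, (Matrix.of G).det ≠ 0 := by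
  induction n with
  | zero => exact Eventually.of_forall fun G => by simp
  | succ n ih =>
    have hset : ∀ n : ℕ, MeasurableSet {G : Fin n → Fin n → ℂ | (Matrix.of G).det = 0} := fun n =>
      measurable_det (measurableSet_singleton 0)
    let f : (Fin (n + 1) → Fin (n + 1) → ℂ) → ℝ≥0∞ :=
      {G | (Matrix.of G).det = 0}.indicator 1
    have hf : Measurable f := measurable_one.indicator (hset _)
    have hinv : ∀ U ∈ Matrix.unitaryGroup (Fin (n + 1)) ℂ, ∀ G,
        f (fun i => G i ᵥ* U) = f G := fun U hU G => by
      have e : Matrix.of (fun i => G i ᵥ* U) = Matrix.of G * U := by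
        ext i j; rfl
      have hU0 : U.det ≠ 0 := fun h0 => by
        have := congrArg Matrix.det (Unitary.mul_star_self_of_mem hU)
        simp [Matrix.det_mul, h0] at this
      simp [f, Set.indicator, e, Matrix.det_mul, hU0]
    have h0 : ∫⁻ G, f G ∂gaussianSquare (n + 1) = 0 := by
      rw [lintegral_gaussianSquare_succ hf hinv, lintegral_eq_zero_of_ae_eq_zero]
      filter_upwards [ae_ne_zero_gaussianVector n] with r hr
      rw [lintegral_eq_zero_of_ae_eq_zero]
      · rfl
      filter_upwards [ih] with G hG
      have hr0 : √(sqNorm r) ≠ 0 := by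
        rw [Real.sqrt_ne_zero (sqNorm_nonneg r)]
        exact fun h => hr (sqNorm_eq_zero.1 h)
      have : ∀ g, f (bordered ((√(sqNorm r) : ℝ) : ℂ) g G) = 0 := fun g => by
        simp [f, det_bordered, hG, hr0]
      simp [this]
    rw [lintegral_indicator_one (hset _)] at h0
    rw [ae_iff]
    simpa using h0

/-! ### Passage to the normalized matrices -/

lemma map_mul_complexGaussian {c : ℝ} {u v : ℝ≥0} (huv : (u : ℝ) = c ^ 2 * v) :
    (complexGaussian v).map (fun z => (c : ℂ) * z) = complexGaussian u := by
  let A : ℂ →L[ℝ] ℂ := c • ContinuousLinearMap.id ℝ ℂ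
  have hA : (fun z : ℂ => (c : ℂ) * z) = A := by
    ext z
    simp [A]
  rw [hA]
  apply Measure.ext_of_charFunDual
  ext L
  rw [charFunDual_map, charFunDual_complexGaussian, charFunDual_complexGaussian]
  have huv' : ((u : ℝ) : ℂ) = (c : ℂ) ^ 2 * (v : ℝ) := by rw [huv]; push_cast; rfl
  rw [huv']
  congr 1
  simp [A]
  ring

/-- Multiplied by `√n`, the normalized Gaussian matrix has standard complex Gaussian entries. -/
lemma IsComplexGaussianMatrix.hasLaw_gaussianSquare {Ω : Type*} [MeasurableSpace Ω]
    {μ : Measure Ω} {n : ℕ} {H : Ω → Matrix (Fin n) (Fin n) ℂ}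
    (hH : IsComplexGaussianMatrix H μ) (hn : 0 < n) :
    HasLaw (fun ω i j => ((√n : ℝ) : ℂ) * H ω i j) (gaussianSquare n) μ := by
  have hv : ((1 : ℝ≥0) : ℝ) = √n ^ 2 * (1 / (n : ℝ≥0) : ℝ≥0) := by
    have hn' : (n : ℝ) ≠ 0 := by exact_mod_cast hn.ne'
    rw [Real.sq_sqrt (Nat.cast_nonneg n)]
    simp [hn']
  have h1 : ∀ ij : Fin n × Fin n,
      HasLaw (fun ω => ((√n : ℝ) : ℂ) * H ω ij.1 ij.2) (complexGaussian 1) μ := fun ij => by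
    have hs : HasLaw (fun z : ℂ => ((√n : ℝ) : ℂ) * z) (complexGaussian 1)
        (complexGaussian (1 / (n : ℝ≥0))) :=
      ⟨by fun_prop, map_mul_complexGaussian hv⟩
    exact hs.comp (hH.hasLaw ij.1 ij.2)
  have h2 : HasLaw (fun ω (ij : Fin n × Fin n) => ((√n : ℝ) : ℂ) * H ω ij.1 ij.2)
      (Measure.pi fun _ => complexGaussian 1) μ :=
    iIndepFun.hasLaw_pi h1 (hH.indep.comp (fun _ z => ((√n : ℝ) : ℂ) * z) fun _ => by fun_prop)
  have h3 : HasLaw (MeasurableEquiv.curry (Fin n) (Fin n) ℂ) (gaussianSquare n)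
      (Measure.pi fun _ => complexGaussian 1) := by
    refine ⟨(MeasurableEquiv.measurable _).aemeasurable, ?_⟩
    have := Measure.infinitePi_map_curry (fun _ _ : Fin n => complexGaussian 1)
    simpa [Measure.infinitePi_eq_pi, gaussianSquare, gaussianVector] using this
  exact h3.comp h2

/-- The first Borel–Cantelli lemma, for a bound that holds from some index on. -/
lemma ae_eventually_of_summable {Ω : Type*} [MeasurableSpace Ω] {μ : Measure Ω}
    {p : ℕ → Ω → Prop} {u : ℕ → ℝ} (hu : Summable u) {n₀ : ℕ}
    (h : ∀ n, n₀ ≤ n → μ {ω | ¬ p n ω} ≤ ENNReal.ofReal (u n)) :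
    ∀ᵐ ω ∂μ, ∀ᶠ n in atTop, p n ω := by
  let s : ℕ → Set Ω := fun n => if n₀ ≤ n then {ω | ¬ p n ω} else ∅
  have hs : ∑' n, μ (s n) ≠ ∞ := by
    refine ne_top_of_le_ne_top hu.tsum_ofReal_ne_top (ENNReal.tsum_le_tsum fun n => ?_)
    by_cases hn : n₀ ≤ n
    · simpa [s, hn] using h n hn
    · simp [s, hn]
  filter_upwards [ae_eventually_notMem hs] with ω hω
  filter_upwards [hω, eventually_ge_atTop n₀] with n hn hn₀
  simpa [s, hn₀] using hn

section

variable {Ω : Type*} [MeasurableSpace Ω] {μ : Measure Ω}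
  {H : (n : ℕ) → Ω → Matrix (Fin n) (Fin n) ℂ}

/-- Almost surely, the `K`-th smallest singular value is eventually below any multiple of `1 / √n`.
This is Markov's inequality for the eighth moment of the least energy. -/
lemma ae_eventually_small_singularValues (hH : ∀ n, IsComplexGaussianMatrix (H n) μ)
    {K : ℕ} (hK : 0 < K) {ε : ℝ} (hε : 0 < ε) :
    ∀ᵐ ω ∂μ, ∀ᶠ n in atTop,
      n * (Matrix.toEuclideanLin (H n ω)).singularValues (n - K) ^ 2 < ε := by
  obtain ⟨B, n₀, hB, hle⟩ := exists_lintegral_minEnergy_le K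
  have hu : Summable fun n : ℕ => 4 * B / ε ^ 8 * (1 / (n : ℝ) ^ 2) :=
    (Real.summable_one_div_nat_pow.2 one_lt_two).mul_left _
  refine ae_eventually_of_summable hu (n₀ := max (n₀ + 2) K) fun n hn => ?_
  obtain ⟨m, rfl⟩ : ∃ m, n = m + 2 := ⟨n - 2, by grind⟩
  have hlaw := (hH (m + 2)).hasLaw_gaussianSquare (by omega)
  have hset : MeasurableSet {G : Fin (m + 2) → Fin (m + 2) → ℂ |
      ENNReal.ofReal ε ^ 8 ≤ minEnergy K G ^ 8} :=
    measurableSet_le measurable_const (by fun_prop)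
  have hsub : {ω | ¬ ((m + 2 : ℕ) * (Matrix.toEuclideanLin (H (m + 2) ω)).singularValues
        (m + 2 - K) ^ 2 < ε)} ⊆ {ω | ENNReal.ofReal ε ^ 8 ≤
          minEnergy K (fun i j => ((√(m + 2 : ℕ) : ℝ) : ℂ) * H (m + 2) ω i j) ^ 8} := by
    intro ω hω
    have h := ofReal_sq_singularValues_le_minEnergy hK (by grind) (√(m + 2 : ℕ)) (H (m + 2) ω)
    rw [Real.sq_sqrt (Nat.cast_nonneg _)] at h
    exact pow_le_pow_left' ((ENNReal.ofReal_le_ofReal (not_lt.1 hω)).trans h) 8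
  refine (measure_mono hsub).trans ?_
  rw [hlaw.measure_eq hset]
  have hmarkov := mul_meas_ge_le_lintegral (μ := gaussianSquare (m + 2))
    (f := fun G => minEnergy K G ^ 8) (by fun_prop) (ENNReal.ofReal ε ^ 8)
  have hε8 : ENNReal.ofReal ε ^ 8 = ENNReal.ofReal (ε ^ 8) := (ENNReal.ofReal_pow hε.le 8).symm
  have h2 := hmarkov.trans (hle m (by grind))
  rw [mul_comm] at h2
  rw [← ENNReal.le_div_iff_mul_le (by left; simp [hε]) (by left; simp [hε8])] at h2
  refine h2.trans ?_
  rw [hε8, ← ENNReal.ofReal_div_of_pos (by positivity)]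
  apply ENNReal.ofReal_le_ofReal
  have h3 : B / ((m : ℝ) + 1) ^ 2 ≤ 4 * B * (1 / ((m + 2 : ℕ) : ℝ) ^ 2) := by
    rw [mul_one_div, div_le_div_iff₀ (by positivity) (by positivity)]
    push_cast
    have : ((m : ℝ) + 2) ^ 2 ≤ 4 * (m + 1) ^ 2 := by
      have : (0 : ℝ) ≤ m := m.cast_nonneg
      nlinarith
    calc B * ((m : ℝ) + 2) ^ 2 ≤ B * (4 * (m + 1) ^ 2) := by gcongr
      _ = _ := by ring
  calc B / ((m : ℝ) + 1) ^ 2 / ε ^ 8 ≤ 4 * B * (1 / ((m + 2 : ℕ) : ℝ) ^ 2) / ε ^ 8 := by gcongr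
    _ = _ := by ring

/-- Almost surely, `n R₁²` eventually exceeds any bound, since `R₁` dominates all entries of a
column. -/
lemma ae_eventually_large_singularValues (hH : ∀ n, IsComplexGaussianMatrix (H n) μ) (M : ℝ) :
    ∀ᵐ ω ∂μ, ∀ᶠ n in atTop,
      M < n * (Matrix.toEuclideanLin (H n ω)).singularValues 0 ^ 2 := by
  set q := complexGaussian 1 {z | ‖z‖ ^ 2 ≤ M} with hq
  have hq1 : q < 1 := complexGaussian_closedBall_lt_one M
  have hqt : q ≠ ∞ := (hq1.trans ENNReal.one_lt_top).ne
  have hu : Summable fun n : ℕ => q.toReal ^ n :=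
    summable_geometric_of_lt_one ENNReal.toReal_nonneg (by
      simpa using (ENNReal.toReal_lt_toReal hqt ENNReal.one_ne_top).2 hq1)
  refine ae_eventually_of_summable hu (n₀ := 1) fun n hn => ?_
  obtain ⟨m, rfl⟩ : ∃ m, n = m + 1 := ⟨n - 1, by omega⟩
  have hlaw := (hH (m + 1)).hasLaw_gaussianSquare (by omega)
  have hset : MeasurableSet {G : Fin (m + 1) → Fin (m + 1) → ℂ | ∀ i, ‖G i 0‖ ^ 2 ≤ M} := by
    simp only [Set.ofPred_forall]
    exact MeasurableSet.iInter fun i => measurableSet_le (by fun_prop) measurable_const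
  have hsub : {ω | ¬ (M < (m + 1 : ℕ) *
      (Matrix.toEuclideanLin (H (m + 1) ω)).singularValues 0 ^ 2)} ⊆
        {ω | ∀ i, ‖((√(m + 1 : ℕ) : ℝ) : ℂ) * H (m + 1) ω i 0‖ ^ 2 ≤ M} := by
    intro ω hω i
    have h1 := (sq_norm_le_sqNorm ((H (m + 1) ω).col 0) i).trans
      (sqNorm_col_le_sq_singularValues (H (m + 1) ω) 0)
    rw [norm_mul, mul_pow, Complex.norm_real, Real.norm_eq_abs, sq_abs,
      Real.sq_sqrt (Nat.cast_nonneg _)]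
    refine le_trans ?_ (not_lt.1 hω)
    exact mul_le_mul_of_nonneg_left h1 (Nat.cast_nonneg _)
  refine (measure_mono hsub).trans ?_
  rw [hlaw.measure_eq hset, gaussianSquare_column_le, ← hq,
    ENNReal.ofReal_pow ENNReal.toReal_nonneg, ENNReal.ofReal_toReal hqt]

lemma ae_forall_singularValues_pos (hH : ∀ n, IsComplexGaussianMatrix (H n) μ) :
    ∀ᵐ ω ∂μ, ∀ n, ∀ i < n, 0 < (Matrix.toEuclideanLin (H n ω)).singularValues i := by
  rw [ae_all_iff]
  intro n
  rcases Nat.eq_zero_or_pos n with rfl | hn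
  · simp
  have hlaw := (hH n).hasLaw_gaussianSquare hn
  have h := hlaw.ae_iff (p := fun G => (Matrix.of G).det ≠ 0)
    (measurableSet_setOfPred.1 (measurable_det (measurableSet_singleton 0).compl))
  filter_upwards [h.2 (ae_det_ne_zero n)] with ω hω i hi
  refine singularValues_pos_of_det_ne_zero (fun h0 => hω ?_) hi
  have e : Matrix.of (fun i j => ((√n : ℝ) : ℂ) * H n ω i j) = ((√n : ℝ) : ℂ) • H n ω := by
    ext i j; rfl
  rw [e, Matrix.det_smul, h0, mul_zero]

end

/-! ### Waterfilling -/

lemma isWaterLevel_waterLevel {n : ℕ} (hn : 0 < n) (η : Fin n → ℝ) {P : ℝ} (hP : 0 < P) :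
    IsWaterLevel η P (waterLevel η P) := by
  have h := (existsUnique_isWaterLevel hn η hP).exists
  rw [waterLevel, dif_pos h]
  exact h.choose_spec

/-- The water level exceeds no noise power by more than the total power. -/
lemma waterLevel_le {n : ℕ} (η : Fin n → ℝ) {P : ℝ} (hP : 0 < P) (i : Fin n) :
    waterLevel η P ≤ P + η i := by
  have h := isWaterLevel_waterLevel i.pos η hP
  have h1 := Finset.single_le_sum (f := fun i => max 0 (waterLevel η P - η i))
    (fun i _ => le_max_left _ _) (Finset.mem_univ i)
  rw [IsWaterLevel] at h
  have h2 := le_max_right 0 (waterLevel η P - η i)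
  linarith

/-- If the strongest subchannel has `1 < n R₁²` and `K` subchannels have
`(P / N + 1) n R² < 1`, then waterfilling switches off these `K` subchannels. -/
lemma le_numDeactivated {n K : ℕ} (hK : 0 < K) (hKn : K ≤ n) {P N : ℝ} (hP : 0 < P) (hN : 0 < N)
    (A : Matrix (Fin n) (Fin n) ℂ)
    (hpos : ∀ i < n, 0 < (Matrix.toEuclideanLin A).singularValues i)
    (h0 : 1 < n * (Matrix.toEuclideanLin A).singularValues 0 ^ 2)
    (h1 : n * (Matrix.toEuclideanLin A).singularValues (n - K) ^ 2 < 1 / (P / N + 1)) :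
    K ≤ numDeactivated P N A := by
  set T := Matrix.toEuclideanLin A
  set η : Fin n → ℝ := fun j => normalizedNoise N A j with hη
  have hn : 0 < n := hK.trans_le hKn
  have hn' : (0 : ℝ) < n := by exact_mod_cast hn
  have hlevel : waterLevel η P ≤ P + N := by
    refine (waterLevel_le η hP ⟨0, hn⟩).trans ?_
    have : η ⟨0, hn⟩ ≤ N := div_le_self hN.le h0.le
    linarith
  have hoff : ∀ i : Fin n, n - K ≤ i → waterfilling η P i = 0 := fun i hi => by
    have hs := hpos i i.2
    have hle : (n : ℝ) * T.singularValues i ^ 2 ≤ 1 / (P / N + 1) := by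
      have := T.singularValues_antitone hi
      exact le_trans (by gcongr) h1.le
    have hbig : P + N ≤ η i := by
      change P + N ≤ N / (n * T.singularValues i ^ 2)
      rw [le_div_iff₀ (by positivity)]
      calc (P + N) * (n * T.singularValues i ^ 2) ≤ (P + N) * (1 / (P / N + 1)) := by gcongr
        _ = N := by field_simp
    exact max_eq_left (by linarith)
  let e : Fin K → Fin n := fun k => ⟨n - K + k, by omega⟩
  have he : Function.Injective e := fun a b hab => by
    have := congrArg Fin.val hab
    simp only [e] at this
    exact Fin.ext (by omega)
  have hcard : (Set.range e).ncard = K := by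
    rw [← Set.image_univ, Set.ncard_image_of_injective _ he, Set.ncard_univ]
    simp
  calc K = (Set.range e).ncard := hcard.symm
    _ ≤ numDeactivated P N A := by
      refine Set.ncard_le_ncard ?_ (Set.toFinite _)
      rintro _ ⟨k, rfl⟩
      exact hoff _ (Nat.le_add_right _ _)

theorem mainTheorem6 {Ω : Type*} [MeasurableSpace Ω] (μ : Measure Ω) [IsProbabilityMeasure μ]
    (H : (n : ℕ) → Ω → Matrix (Fin n) (Fin n) ℂ)
    (hH : ∀ n, IsComplexGaussianMatrix (H n) μ)
    (snr : ℝ) (hsnr : 0 < snr) (P N : ℕ → ℝ)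
    (hN : ∀ n, 0 < N n) (hPN : ∀ n, P n / N n = snr) :
    (∀ᵐ ω ∂μ, ∃ L : ℕ∞, 0 < L ∧
      Tendsto (fun n => (numDeactivated (P n) (N n) (H n ω) : ℕ∞)) atTop (𝓝 L)) ∧
    (∀ N₀ : ℝ, 0 < N₀ →
      (∀ᵐ ω ∂μ, Tendsto (fun n => normalizedNoise N₀ (H n ω) (n - 1)) atTop atTop) ∧
      (∀ᵐ ω ∂μ, Tendsto (fun n => normalizedNoise N₀ (H n ω) 0) atTop (𝓝 0))) := by
  have hpos := ae_forall_singularValues_pos hH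
  refine ⟨?_, fun N₀ hN₀ => ⟨?_, ?_⟩⟩
  · have hsmall : ∀ᵐ ω ∂μ, ∀ K : ℕ, ∀ᶠ n : ℕ in atTop,
        n * (Matrix.toEuclideanLin (H n ω)).singularValues (n - (K + 1)) ^ 2 < 1 / (snr + 1) :=
      ae_all_iff.2 fun K => ae_eventually_small_singularValues hH K.succ_pos (by positivity)
    filter_upwards [hpos, hsmall, ae_eventually_large_singularValues hH 1] with ω hp hs hl
    refine ⟨⊤, by simp, ?_⟩
    rw [ENat.tendsto_nhds_top_iff_natCast_lt]
    intro K
    filter_upwards [hs K, hl, eventually_ge_atTop (K + 1)] with n h1 h0 hn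
    have hP : 0 < P n := by
      have h := hPN n
      rw [div_eq_iff (hN n).ne'] at h
      rw [h]
      exact mul_pos hsnr (hN n)
    have := le_numDeactivated K.succ_pos hn hP (hN n) (H n ω) (hp n) h0 (by rwa [hPN n])
    exact_mod_cast this
  · have hsmall : ∀ᵐ ω ∂μ, ∀ k : ℕ, ∀ᶠ n : ℕ in atTop,
        n * (Matrix.toEuclideanLin (H n ω)).singularValues (n - 1) ^ 2 < N₀ / (k + 1) :=
      ae_all_iff.2 fun k => ae_eventually_small_singularValues hH one_pos (by positivity)
    filter_upwards [hpos, hsmall] with ω hp hs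
    refine tendsto_atTop.2 fun b => ?_
    obtain ⟨k, hk⟩ := exists_nat_ge b
    filter_upwards [hs k, eventually_gt_atTop 0] with n h1 hn
    have hn' : (0 : ℝ) < n := by exact_mod_cast hn
    have hpn := hp n (n - 1) (by omega)
    refine hk.trans ?_
    rw [normalizedNoise, le_div_iff₀ (by positivity)]
    rw [lt_div_iff₀ (by positivity)] at h1
    nlinarith [mul_pos hn' (pow_pos hpn 2)]
  · have hlarge : ∀ᵐ ω ∂μ, ∀ k : ℕ, ∀ᶠ n : ℕ in atTop,
        k < n * (Matrix.toEuclideanLin (H n ω)).singularValues 0 ^ 2 :=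
      ae_all_iff.2 fun k => ae_eventually_large_singularValues hH k
    filter_upwards [hlarge] with ω hl
    refine Tendsto.const_div_atTop (tendsto_atTop.2 fun b => ?_) N₀
    obtain ⟨k, hk⟩ := exists_nat_ge b
    filter_upwards [hl k] with n hn using hk.trans hn.le
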